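/- Work in Type-2 computability: a partial function $F:\subseteq\mathbb{N}^{\mathbb{N}}\to\mathbb{N}^{\mathbb{N}}$ is computable if some oracle machine, given oracle $p\in\mathrm{dom}(F)$ and input $n$, outputs $F(p)(n)$; $\langle p,q\rangle=p(0)q(0)p(1)q(1)\dots$ is the pairing on $\mathbb{N}^{\mathbb{N}}$. A represented space is a set $X$ with a surjective partial map $\sigma_X:\subseteq\mathbb{N}^{\mathbb{N}}\to X$; if $\sigma_X(p)=x$, then $p$ is called a name of $x$. A partial function $F:\subseteq\mathbb{N}^{\mathbb{N}}\to\mathbb{N}^{\mathbb{N}}$ realizes a partial multi-valued function $f:\subseteq X\rightrightarrows Y$ between represented spaces if $\sigma_Y(F(p))\in f(\sigma_X(p))$ whenever $\sigma_X(p)\in\mathrm{dom}(f)$. Write $f\le_{\mathrm W} g$ if there are computable $H,K:\subseteq\mathbb{N}^{\mathbb{N}}\to\mathbb{N}^{\mathbb{N}}$ such that $p\mapsto H\langle p,G(K(p))\rangle$ realizes $f$ whenever $G$ realizes $g$, and $f\equiv_{\mathrm W} g$ if $f\le_{\mathrm W} g$ and $g\le_{\mathrm W} f$. Let $(\alpha(n))_n$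 and $(q_m)_m$ be standard effective enumerations of $\mathbb{Q}$ and of $\mathbb{Q}_{\ge 0}$, and let $B_{\langle n,m\rangle}=\{x\in\mathbb{R}:|x-\alpha(n)|<q_m\}$. A name of $x\in\mathbb{R}$ is a $p$ with $|\alpha(p(i))-\alpha(p(j))|\le 2^{-i}$ for all $j\ge i$ and $\lim_n\alpha(p(n))=x$. A (total information) name of a nonempty closed $A\subseteq\mathbb{R}$ is a $\langle p_0,p_1\rangle$ with $A=\mathbb{R}\setminus\bigcup_{k\in\mathrm{range}(p_0)}B_k$ and $\mathrm{range}(p_1)=\{k: B_k\cap A\ne\emptyset\}$. Names of pairs are pairs of names, an element of $\mathbb{N}^{\mathbb{N}}$ is its own name, and $p$ is a name of $i\in\{0,1\}$ if $p(0)=i$. The total projection operator $\mathrm{Proj}_{\mathbb{R}}$ maps each pair $(x,A)$ of a point $x\in\mathbb{R}$ and a nonempty closed set $A\subseteq\mathbb{R}$ to the set of all $y\in A$ with $|x-y|=\inf_{z\in A}|x-z|$. The operator $\mathrm{LLPO}:\subseteq\mathbb{N}^{\mathbb{N}}\times\mathbb{N}^{\mathbb{N}}\rightrightarrows\{0,1\}$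 is defined on the pairs $(p_0,p_1)$ such that $p_j(n)\ne 0$ for at most one pair $(j,n)\in\{0,1\}\times\mathbb{N}$, and $i\in\mathrm{LLPO}(p_0,p_1)$ iff $p_i(n)=0$ for all $n$. Then $\mathrm{Proj}_{\mathbb{R}}\equiv_{\mathrm W}\mathrm{LLPO}$. -/

import Mathlib

namespace Weihrauch

/-- Baire space `ℕ^ℕ`. -/
abbrev Baire : Type := ℕ → ℕ

/-! ### Type-2 computability -/

/-- Partial recursive functionals `Φ : ℕ^ℕ × ℕ ⇀ ℕ`: the functions computed by oracle machines,
uniformly in the oracle `p`. These are the clauses of `Nat.RecursiveIn`, with the oracle kept as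
an argument of the functional. -/
inductive RecFunctional : (Baire → ℕ →. ℕ) → Prop
  | zero : RecFunctional fun _ _ => Part.some 0
  | succ : RecFunctional fun _ n => Part.some (n + 1)
  | left : RecFunctional fun _ n => Part.some n.unpair.1
  | right : RecFunctional fun _ n => Part.some n.unpair.2
  | oracle : RecFunctional fun p n => Part.some (p n)
  | pair {Φ Ψ : Baire → ℕ →. ℕ} (hΦ : RecFunctional Φ) (hΨ : RecFunctional Ψ) :
      RecFunctional fun p n => (Φ p n).bind fun a => (Ψ p n).map fun b => Nat.pair a b
  | comp {Φ Ψ : Baire → ℕ →. ℕ} (hΦ : RecFunctional Φ) (hΨ : RecFunctional Ψ) :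
      RecFunctional fun p n => (Ψ p n).bind (Φ p)
  | prec {Φ Ψ : Baire → ℕ →. ℕ} (hΦ : RecFunctional Φ) (hΨ : RecFunctional Ψ) :
      RecFunctional fun p n =>
        Nat.rec (motive := fun _ => Part ℕ) (Φ p n.unpair.1)
          (fun y ih => ih.bind fun i => Ψ p (Nat.pair n.unpair.1 (Nat.pair y i))) n.unpair.2
  | rfind {Φ : Baire → ℕ →. ℕ} (hΦ : RecFunctional Φ) :
      RecFunctional fun p a =>
        Nat.rfind fun n => (Φ p (Nat.pair a n)).map fun m => decide (m = 0)

/-- A partial function `F :⊆ ℕ^ℕ → ℕ^ℕ` is computable if some oracle machine outputs, on oracle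
`p` and input `n`, the value `F(p)(n)`; the domain of `F` consists of the `p` for which the machine
halts on every `n`. -/
def IsComputable (F : Baire →. Baire) : Prop :=
  ∃ Φ : Baire → ℕ →. ℕ, RecFunctional Φ ∧ ∀ p q, q ∈ F p ↔ ∀ n, q n ∈ Φ p n

/-- The pairing `⟨p, q⟩ = p(0) q(0) p(1) q(1) …` of Baire space. -/
def join (p q : Baire) : Baire := fun n => if n % 2 = 0 then p (n / 2) else q (n / 2)

/-- The first component of `r = ⟨p, q⟩`. -/
def fstPart (r : Baire) : Baire := fun n => r (2 * n)

/-- The second component of `r = ⟨p, q⟩`. -/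
def sndPart (r : Baire) : Baire := fun n => r (2 * n + 1)

theorem fstPart_join (p q : Baire) : fstPart (join p q) = p := by
  funext n
  simp [fstPart, join]

theorem sndPart_join (p q : Baire) : sndPart (join p q) = q := by
  funext n
  have h1 : (2 * n + 1) % 2 = 1 := by omega
  have h2 : (2 * n + 1) / 2 = n := by omega
  simp [sndPart, join, h1, h2]

/-! ### Represented spaces -/

/-- A representation of `X`: a surjective partial function `σ :⊆ ℕ^ℕ → X`, given by its graph
`Names p x ↔ σ(p) = x`. -/
structure Representation (X : Type) where
  Names : Baire → X → Prop
  unique : ∀ {p x y}, Names p x → Names p y → x = y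
  surj : ∀ x, ∃ p, Names p x

/-- Baire space, represented by the identity. -/
def baireRep : Representation Baire where
  Names p x := p = x
  unique h h' := h.symm.trans h'
  surj x := ⟨x, rfl⟩

/-- `{0, 1}` with the discrete representation: `p` names `i` iff `p(0) = i`. -/
def twoRep : Representation (Fin 2) where
  Names p i := p 0 = i
  unique h h' := Fin.ext (h.symm.trans h')
  surj i := ⟨fun _ => i, rfl⟩

/-- The product representation: `⟨p, q⟩` names `(x, y)` iff `p` names `x` and `q` names `y`. -/
def prodRep {X Y : Type} (σ : Representation X) (τ : Representation Y) :
    Representation (X × Y) where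
  Names r z := σ.Names (fstPart r) z.1 ∧ τ.Names (sndPart r) z.2
  unique h h' := Prod.ext (σ.unique h.1 h'.1) (τ.unique h.2 h'.2)
  surj z := by
    obtain ⟨p, hp⟩ := σ.surj z.1
    obtain ⟨q, hq⟩ := τ.surj z.2
    exact ⟨join p q, by rwa [fstPart_join], by rwa [sndPart_join]⟩

/-! ### Weihrauch reducibility -/

/-- A partial multi-valued function `f :⊆ X ⇉ Y` between represented spaces; its domain is
`{x | f x ≠ ∅}`. -/
structure Problem where
  {X Y : Type}
  repX : Representation X
  repY : Representation Y
  f : X → Set Y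

/-- `F ⊢ f`: for every name `p` of a point `x ∈ dom f`, `F(p)` is defined and names a point of
`f(x)`. -/
def Realizes (F : Baire →. Baire) (P : Problem) : Prop :=
  ∀ p x, P.repX.Names p x → (P.f x).Nonempty →
    ∃ q ∈ F p, ∃ y ∈ P.f x, P.repY.Names q y

/-- `P ≤_W Q`: there are computable `H`, `K` such that `p ↦ H⟨p, G(K(p))⟩` realizes `P` whenever
`G` realizes `Q`. -/
def Reducible (P Q : Problem) : Prop :=
  ∃ H K : Baire →. Baire, IsComputable H ∧ IsComputable K ∧
    ∀ G : Baire →. Baire, Realizes G Q →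
      Realizes (fun p => (K p).bind fun q => (G q).bind fun r => H (join p r)) P

/-- `P ≡_W Q`. -/
def Equivalent (P Q : Problem) : Prop := Reducible P Q ∧ Reducible Q P

/-- `LLPO`: given `(p₀, p₁)` such that `p_j(n) ≠ 0` for at most one pair `(j, n)`, find `i` with
`p_i = 0^ℕ`. -/
def LLPO : Problem where
  repX := prodRep baireRep baireRep
  repY := twoRep
  f p := {i | (∀ j j' : Fin 2, ∀ n n' : ℕ,
      ![p.1, p.2] j n ≠ 0 → ![p.1, p.2] j' n' ≠ 0 → j = j' ∧ n = n') ∧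
    ∀ n, ![p.1, p.2] i n = 0}

/-! ### Computable metric spaces and their hyperspaces of closed sets -/

/-- An effective enumeration of the nonnegative rationals: `q_⟨a, b⟩ = a / (b + 1)`. -/
def nnratEnum (m : ℕ) : ℚ := (m.unpair.1 : ℚ) / ((m.unpair.2 : ℚ) + 1)

/-- An effective enumeration of the rationals: `α(⟨⟨a, a'⟩, b⟩) = (a - a') / (b + 1)`. -/
def ratEnum (n : ℕ) : ℚ :=
  ((n.unpair.1.unpair.1 : ℚ) - (n.unpair.1.unpair.2 : ℚ)) / ((n.unpair.2 : ℚ) + 1)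

/-- A computable metric space structure on `X`: a dense sequence `α` such that `d(α(i), α(j))` is a
computable double sequence of reals. -/
structure ComputableMetric (X : Type) [MetricSpace X] where
  α : ℕ → X
  dense : DenseRange α
  computable_dist : ∃ g : ℕ × ℕ × ℕ → ℕ, Computable g ∧
    ∀ i j k, |dist (α i) (α j) - (nnratEnum (g (i, j, k)) : ℝ)| ≤ (1 / 2 : ℝ) ^ k

section Metric

variable {X : Type} [MetricSpace X] (C : ComputableMetric X)

/-- The Cauchy representation. -/
def cauchyRep : Representation X where
  Names p x := (∀ i j, i ≤ j → dist (C.α (p i)) (C.α (p j)) ≤ (1 / 2 : ℝ) ^ i) ∧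
    Filter.Tendsto (fun n => C.α (p n)) Filter.atTop (nhds x)
  unique h h' := tendsto_nhds_unique h.2 h'.2
  surj x := by
    have h : ∀ i : ℕ, ∃ n, dist x (C.α n) < (1 / 2 : ℝ) ^ (i + 1) := fun i =>
      C.dense.exists_dist_lt x (by positivity)
    choose p hp using h
    refine ⟨p, fun i j hij => ?_, ?_⟩
    · have h1 := dist_triangle_left (C.α (p i)) (C.α (p j)) x
      have h2 : (1 / 2 : ℝ) ^ (j + 1) ≤ (1 / 2 : ℝ) ^ (i + 1) :=
        pow_le_pow_of_le_one (by norm_num) (by norm_num) (by omega)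
      have h3 : (1 / 2 : ℝ) ^ (i + 1) = (1 / 2 : ℝ) ^ i / 2 := by ring
      linarith [hp i, hp j]
    · rw [tendsto_iff_dist_tendsto_zero]
      refine squeeze_zero (fun _ => dist_nonneg) (fun n => ?_)
        ((tendsto_pow_atTop_nhds_zero_of_lt_one (r := (1 / 2 : ℝ)) (by norm_num)
          (by norm_num)).comp (Filter.tendsto_add_atTop_nat 1))
      rw [dist_comm]
      exact (hp n).le

/-- The basic open ball `B_⟨n, m⟩ = B(α(n), q_m)`. -/
def basicBall (k : ℕ) : Set X := Metric.ball (C.α k.unpair.1) (nnratEnum k.unpair.2 : ℝ)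

/-- `p` is a negative-information name of `A`: it enumerates basic balls exhausting the
complement of `A`. -/
def NegName (p : Baire) (A : Set X) : Prop := A = (⋃ k ∈ Set.range p, basicBall C k)ᶜ

/-- `p` is a positive-information name of `A`: it enumerates exactly the basic balls that
meet `A`. -/
def PosName (p : Baire) (A : Set X) : Prop :=
  ∀ k, k ∈ Set.range p ↔ (basicBall C k ∩ A).Nonempty

theorem exists_basicBall {U : Set X} (hU : IsOpen U) {x : X} (hx : x ∈ U) :
    ∃ k, x ∈ basicBall C k ∧ basicBall C k ⊆ U := by
  obtain ⟨ε, hε, hεU⟩ := Metric.isOpen_iff.1 hU x hx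
  obtain ⟨b, hb⟩ := exists_nat_one_div_lt (half_pos hε)
  obtain ⟨n, hn⟩ := C.dense.exists_dist_lt x (ε := 1 / ((b : ℝ) + 1)) (by positivity)
  refine ⟨Nat.pair n (Nat.pair 1 b), ?_, fun y hy => hεU ?_⟩
  · simpa [basicBall, nnratEnum] using hn
  · have hy' : dist y (C.α n) < 1 / ((b : ℝ) + 1) := by simpa [basicBall, nnratEnum] using hy
    have := dist_triangle_right y x (C.α n)
    rw [Metric.mem_ball]
    linarith

theorem exists_negName {A : Set X} (hA : IsClosed A) : ∃ p, NegName C p A := by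
  have hne : {k | basicBall C k ⊆ Aᶜ}.Nonempty :=
    ⟨Nat.pair 0 (Nat.pair 0 0), by simp [basicBall, nnratEnum]⟩
  obtain ⟨p, hp⟩ := (Set.to_countable {k | basicBall C k ⊆ Aᶜ}).exists_eq_range hne
  refine ⟨p, ?_⟩
  rw [NegName, ← hp, eq_compl_comm]
  refine Set.Subset.antisymm (Set.iUnion₂_subset fun k hk => hk) fun x hx => ?_
  obtain ⟨k, hxk, hk⟩ := exists_basicBall C hA.isOpen_compl hx
  exact Set.mem_biUnion (s := {k | basicBall C k ⊆ Aᶜ}) hk hxk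

theorem exists_posName {A : Set X} (hA : A.Nonempty) : ∃ p, PosName C p A := by
  have hne : {k | (basicBall C k ∩ A).Nonempty}.Nonempty := by
    obtain ⟨x, hx⟩ := hA
    obtain ⟨k, hk, -⟩ := exists_basicBall C isOpen_univ (Set.mem_univ x)
    exact ⟨k, x, hk, hx⟩
  obtain ⟨p, hp⟩ := (Set.to_countable _).exists_eq_range hne
  exact ⟨p, fun k => by rw [← hp]; rfl⟩

/-- The nonempty closed subsets of `X`. The empty set has no positive name, since the range of a
sequence is nonempty, and it is outside the domain of the projection operators. -/
abbrev NonemptyClosed (X : Type) [MetricSpace X] : Type :=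
  {A : Set X // IsClosed A ∧ A.Nonempty}

/-- The total-information representation: `⟨p₀, p₁⟩` names `A` iff `p₀` is a negative and `p₁` a
positive name of `A`. -/
def totalRep : Representation (NonemptyClosed X) where
  Names r A := NegName C (fstPart r) A ∧ PosName C (sndPart r) A
  unique h h' := Subtype.ext (Eq.trans h.1 (Eq.symm h'.1))
  surj A := by
    obtain ⟨p, hp⟩ := exists_negName C A.2.1
    obtain ⟨q, hq⟩ := exists_posName C A.2.2
    exact ⟨join p q, by rwa [fstPart_join], by rwa [sndPart_join]⟩

/-- The exact total projection operator `Proj_X`: given `x` and a nonempty closed `A`, find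
`y ∈ A` with `d(x, y) = d(x, A)`. -/
noncomputable def Proj : Problem where
  repX := prodRep (cauchyRep C) (totalRep C)
  repY := cauchyRep C
  f z := {y | y ∈ z.2.1 ∧ dist z.1 y = Metric.infDist z.1 z.2.1}

end Metric

theorem ratEnum_surjective : Function.Surjective ratEnum := by
  intro q
  refine ⟨Nat.pair (Nat.pair q.num.toNat (-q.num).toNat) (q.den - 1), ?_⟩
  have h1 : ((q.num.toNat : ℚ) - ((-q.num).toNat : ℚ)) = (q.num : ℚ) := by
    have : ((q.num.toNat : ℤ) - ((-q.num).toNat : ℤ)) = q.num := by omega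
    exact_mod_cast this
  have h2 : ((q.den - 1 : ℕ) : ℚ) + 1 = q.den := by
    have : q.den - 1 + 1 = q.den := Nat.sub_add_cancel q.pos
    exact_mod_cast this
  simp only [ratEnum, Nat.unpair_pair, h1, h2, Rat.num_div_den]

/-- The (exact) distance of two rationals, on codes. -/
def ratDistCode (i j : ℕ) : ℕ :=
  let u := i.unpair.1.unpair.1 * (j.unpair.2 + 1) + j.unpair.1.unpair.2 * (i.unpair.2 + 1)
  let v := i.unpair.1.unpair.2 * (j.unpair.2 + 1) + j.unpair.1.unpair.1 * (i.unpair.2 + 1)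
  Nat.pair ((u - v) + (v - u)) ((i.unpair.2 + 1) * (j.unpair.2 + 1) - 1)

theorem nnratEnum_ratDistCode (i j : ℕ) :
    nnratEnum (ratDistCode i j) = |ratEnum i - ratEnum j| := by
  simp only [nnratEnum, ratDistCode, ratEnum, Nat.unpair_pair]
  generalize i.unpair.1.unpair.1 = a
  generalize i.unpair.1.unpair.2 = a'
  generalize i.unpair.2 = b
  generalize j.unpair.1.unpair.1 = c
  generalize j.unpair.1.unpair.2 = c'
  generalize j.unpair.2 = d
  have hden : (((b + 1) * (d + 1) - 1 : ℕ) : ℚ) + 1 = ((b : ℚ) + 1) * ((d : ℚ) + 1) := by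
    have : (b + 1) * (d + 1) - 1 + 1 = (b + 1) * (d + 1) :=
      Nat.sub_add_cancel (Nat.mul_pos b.succ_pos d.succ_pos)
    exact_mod_cast this
  have hnum : ∀ u v : ℕ, (((u - v) + (v - u) : ℕ) : ℚ) = |(u : ℚ) - v| := by
    intro u v
    have : (((u - v) + (v - u) : ℕ) : ℤ) = |(u : ℤ) - v| := by
      rcases abs_cases ((u : ℤ) - v) with h | h <;> omega
    exact_mod_cast this
  have hb : (0 : ℚ) < (b : ℚ) + 1 := by positivity
  have hd : (0 : ℚ) < (d : ℚ) + 1 := by positivity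
  rw [hnum, hden, ← abs_of_pos (mul_pos hb hd), ← abs_div]
  congr 1
  push_cast
  field_simp
  ring

theorem ratDistCode_primrec : Primrec₂ ratDistCode := by
  have l : Primrec fun n : ℕ => n.unpair.1 := Primrec.fst.comp Primrec.unpair
  have r : Primrec fun n : ℕ => n.unpair.2 := Primrec.snd.comp Primrec.unpair
  have hi : Primrec fun x : ℕ × ℕ => x.1 := Primrec.fst
  have hj : Primrec fun x : ℕ × ℕ => x.2 := Primrec.snd
  have s : ∀ {f : ℕ × ℕ → ℕ}, Primrec f → Primrec fun x => f x + 1 := fun h =>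
    Primrec.succ.comp h
  have hu := Primrec.nat_add.comp
    (Primrec.nat_mul.comp (l.comp (l.comp hi)) (s (r.comp hj)))
    (Primrec.nat_mul.comp (r.comp (l.comp hj)) (s (r.comp hi)))
  have hv := Primrec.nat_add.comp
    (Primrec.nat_mul.comp (r.comp (l.comp hi)) (s (r.comp hj)))
    (Primrec.nat_mul.comp (l.comp (l.comp hj)) (s (r.comp hi)))
  exact Primrec₂.natPair.comp
    (Primrec.nat_add.comp (Primrec.nat_sub.comp hu hv) (Primrec.nat_sub.comp hv hu))
    (Primrec.nat_sub.comp (Primrec.nat_mul.comp (s (r.comp hi)) (s (r.comp hj)))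
      (Primrec.const 1))

/-- `ℝ` with the Euclidean metric and the effective enumeration of the rationals. -/
noncomputable def realMetric : ComputableMetric ℝ where
  α n := (ratEnum n : ℝ)
  dense := Rat.isDenseEmbedding_coe_real.dense.comp ratEnum_surjective.denseRange
    Rat.continuous_coe_real
  computable_dist := by
    refine ⟨fun x => ratDistCode x.1 x.2.1, (ratDistCode_primrec.comp Primrec.fst
      (Primrec.fst.comp Primrec.snd)).to_comp, fun i j k => ?_⟩
    have : dist (ratEnum i : ℝ) (ratEnum j : ℝ) = (nnratEnum (ratDistCode i j) : ℝ) := by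
      rw [nnratEnum_ratDistCode, Real.dist_eq]
      push_cast
      rfl
    rw [this, sub_self, abs_zero]
    positivity

end Weihrauch

namespace Weihrauch

open Encodable

/-! ### Total functionals that are recursive in the oracle -/

/-! On the line, only `x - d` and `x + d` have distance `d` from `x`. With `d = d(x, A)`, at least
one of these two candidates lies in `A`, because a nonempty closed set of reals attains its distance
(`candidate_mem`). A name with total information makes `d` computable: by compactness, negative
information certifies lower bounds (`distLower_le_infDist`, `exists_uniform_cover`), positive
information certifies upper bounds (`infDist_le_distUpper`), and the two meet
(`exists_approxError_lt`). Hence both candidates are computable reals, and only the choice between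
them is not computable.

Non-membership in `A` is recognised in finite time (`exists_refutes_iff`), and at most one candidate
can be refuted. Marking the least refutation of each candidate therefore gives an instance of
`LLPO`, whose answer names a candidate that is never refuted, that is, a projection.

Conversely, `(p₀, p₁)` is coded by `x = 0` and `A = {-1 - a, 1 + b}`, where `a` is `2⁻ⁿ` if `p₀` has
its first nonzero entry at `n`, and `0` if `p₀` vanishes; `b` is obtained likewise from `p₁`. One of
`a`, `b` is `0`, so a nearest point on the left forces `a = 0` and one on the right forces `b = 0`.
As the nearest point has modulus at least `1`, a rough approximation reveals its sign. -/

/-- A total function `f : ℕ^ℕ × α → β` is computed by an oracle machine on codes. -/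
def OracleComputable {α β : Type} [Primcodable α] [Primcodable β] (f : Baire → α → β) : Prop :=
  ∃ φ : Baire → ℕ → ℕ, RecFunctional (fun p n => Part.some (φ p n)) ∧
    ∀ p a, φ p (encode a) = encode (f p a)

theorem RecFunctional.of_eq {Φ Ψ : Baire → ℕ →. ℕ} (hΦ : RecFunctional Φ)
    (h : ∀ p n, Φ p n = Ψ p n) : RecFunctional Ψ :=
  (funext₂ h : Φ = Ψ) ▸ hΦ

/-- Every clause of `Nat.Primrec` has a counterpart for functionals, so the whole `Primrec` library
becomes available relative to an oracle. -/
theorem RecFunctional.of_natPrimrec {f : ℕ → ℕ} (hf : Nat.Primrec f) :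
    RecFunctional fun _ n => Part.some (f n) := by
  induction hf with
  | zero => exact .zero
  | succ => exact .succ
  | left => exact .left
  | right => exact .right
  | pair _ _ h₁ h₂ => simpa using h₁.pair h₂
  | comp _ _ h₁ h₂ => simpa using h₁.comp h₂
  | @prec f g _ _ h₁ h₂ =>
    refine (h₁.prec h₂).of_eq fun p n => ?_
    simp only [Nat.unpaired]
    induction n.unpair.2 with
    | zero => rfl
    | succ m ih => simp [ih]

namespace OracleComputable

variable {α β γ δ : Type} [Primcodable α] [Primcodable β] [Primcodable γ] [Primcodable δ]

theorem of_primrec {f : α → β} (hf : Primrec f) : OracleComputable fun _ a => f a := by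
  -- `Primrec f` concerns the code of an `Option`, where `some b` has code `encode b + 1`; the
  -- predecessor removes the shift.
  refine ⟨fun _ n => (encode ((decode (α := α) n).map f)).pred,
    RecFunctional.of_natPrimrec (Nat.Primrec.pred.comp hf), fun p a => ?_⟩
  simp

theorem comp {f : Baire → β → γ} {g : Baire → α → β} (hf : OracleComputable f)
    (hg : OracleComputable g) : OracleComputable fun p a => f p (g p a) := by
  obtain ⟨φ, hφ, hf⟩ := hf
  obtain ⟨ψ, hψ, hg⟩ := hg
  exact ⟨fun p n => φ p (ψ p n), by simpa using hφ.comp hψ, fun p a => by simp only [hg, hf]⟩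

theorem prodMk {f : Baire → α → β} {g : Baire → α → γ} (hf : OracleComputable f)
    (hg : OracleComputable g) : OracleComputable fun p a => (f p a, g p a) := by
  obtain ⟨φ, hφ, hf⟩ := hf
  obtain ⟨ψ, hψ, hg⟩ := hg
  exact ⟨fun p n => Nat.pair (φ p n) (ψ p n), by simpa using hφ.pair hψ,
    fun p a => by simp only [hg, hf, encode_prod_val]⟩

theorem comp₁ {f : β → γ} {g : Baire → α → β} (hf : Primrec f)
    (hg : OracleComputable g) : OracleComputable fun p a => f (g p a) :=
  (of_primrec hf).comp hg

theorem comp₂ {f : β → γ → δ} {g : Baire → α → β} {h : Baire → α → γ} (hf : Primrec₂ f)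
    (hg : OracleComputable g) (hh : OracleComputable h) :
    OracleComputable fun p a => f (g p a) (h p a) :=
  comp₁ hf (hg.prodMk hh)

theorem const (b : β) : OracleComputable fun _ (_ : α) => b := of_primrec (Primrec.const b)

theorem query {f : Baire → α → ℕ} (hf : OracleComputable f) :
    OracleComputable fun p a => p (f p a) :=
  comp (f := fun p n => p n) ⟨fun p n => p n, RecFunctional.oracle, fun _ _ => rfl⟩ hf

theorem nat_rec {f : Baire → α → β} {g : Baire → α × ℕ × β → β} {n : Baire → α → ℕ}
    (hf : OracleComputable f) (hg : OracleComputable g) (hn : OracleComputable n) :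
    OracleComputable fun p a =>
      Nat.rec (motive := fun _ => β) (f p a) (fun m b => g p (a, m, b)) (n p a) := by
  obtain ⟨φ, hφ, hf⟩ := hf
  obtain ⟨ψ, hψ, hg⟩ := hg
  -- The clause `prec` recurses on the second half of a paired input, so the counter is first made
  -- an independent argument.
  refine comp (f := fun p (x : α × ℕ) => Nat.rec (motive := fun _ => β) (f p x.1)
    (fun m b => g p (x.1, m, b)) x.2) (g := fun p a => (a, n p a)) ?_
    ((of_primrec Primrec.id).prodMk hn)
  refine ⟨fun p k => Nat.rec (motive := fun _ => ℕ) (φ p k.unpair.1)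
    (fun m b => ψ p (Nat.pair k.unpair.1 (Nat.pair m b))) k.unpair.2, ?_, ?_⟩
  · refine (hφ.prec hψ).of_eq fun p k => ?_
    beta_reduce
    induction k.unpair.2 with
    | zero => rfl
    | succ m ih => simp [ih]
  · rintro p ⟨a, k⟩
    simp only [encode_prod_val, Nat.unpair_pair, encode_nat]
    induction k with
    | zero => exact hf p a
    | succ m ih =>
      simp only [ih, ← hg]
      rfl

theorem cond {c : Baire → α → Bool} {f g : Baire → α → β} (hc : OracleComputable c)
    (hf : OracleComputable f) (hg : OracleComputable g) :
    OracleComputable fun p a => bif c p a then f p a else g p a :=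
  comp₁ (f := fun x : Bool × β × β => bif x.1 then x.2.1 else x.2.2)
    (Primrec.cond Primrec.fst (Primrec.fst.comp Primrec.snd) (Primrec.snd.comp Primrec.snd))
    (hc.prodMk (hf.prodMk hg))

end OracleComputable

open Classical in
/-- A relation between `ℕ^ℕ` and `α` that is decided by an oracle machine. -/
def OracleDecidable {α : Type} [Primcodable α] (P : Baire → α → Prop) : Prop :=
  OracleComputable fun p a => decide (P p a)

namespace OracleDecidable

variable {α β γ : Type} [Primcodable α] [Primcodable β] [Primcodable γ]

theorem of_bool {c : Baire → α → Bool} (hc : OracleComputable c) {P : Baire → α → Prop}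
    (h : ∀ p a, c p a = true ↔ P p a) : OracleDecidable P := by
  classical
  have : c = fun p a => decide (P p a) := funext₂ fun p a => by simp [← h]
  rw [this] at hc
  unfold OracleDecidable
  convert hc

theorem ite {P : Baire → α → Prop} [∀ p a, Decidable (P p a)] {f g : Baire → α → β}
    (hP : OracleDecidable P) (hf : OracleComputable f) (hg : OracleComputable g) :
    OracleComputable fun p a => if P p a then f p a else g p a := by
  convert OracleComputable.cond hP hf hg using 3 with p a
  by_cases h : P p a <;> simp [h]

theorem of_primrecRel {R : β → γ → Prop} (hR : PrimrecRel R) {f : Baire → α → β}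
    {g : Baire → α → γ} (hf : OracleComputable f) (hg : OracleComputable g) :
    OracleDecidable fun p a => R (f p a) (g p a) := by
  classical
  exact of_bool (OracleComputable.comp₂ hR.decide hf hg) fun p a => by simp

theorem comp {P : Baire → β → Prop} {f : Baire → α → β} (hP : OracleDecidable P)
    (hf : OracleComputable f) : OracleDecidable fun p a => P p (f p a) :=
  OracleComputable.comp hP hf

theorem not {P : Baire → α → Prop} (hP : OracleDecidable P) :
    OracleDecidable fun p a => ¬ P p a := by
  exact of_bool (OracleComputable.comp₁ (Primrec.dom_bool Bool.not) hP) fun p a => by simp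

theorem and {P Q : Baire → α → Prop} (hP : OracleDecidable P) (hQ : OracleDecidable Q) :
    OracleDecidable fun p a => P p a ∧ Q p a := by
  exact of_bool (OracleComputable.comp₂ (Primrec.dom_bool₂ Bool.and) hP hQ) fun p a => by simp

theorem or {P Q : Baire → α → Prop} (hP : OracleDecidable P) (hQ : OracleDecidable Q) :
    OracleDecidable fun p a => P p a ∨ Q p a := by
  exact of_bool (OracleComputable.comp₂ (Primrec.dom_bool₂ Bool.or) hP hQ) fun p a => by simp

theorem forall_lt {P : Baire → α × ℕ → Prop} {n : Baire → α → ℕ} (hP : OracleDecidable P)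
    (hn : OracleComputable n) : OracleDecidable fun p a => ∀ m < n p a, P p (a, m) := by
  classical
  have h := OracleComputable.nat_rec (g := fun p (x : α × ℕ × Bool) =>
    x.2.2 && decide (P p (x.1, x.2.1))) (OracleComputable.const (α := α) true)
    (OracleComputable.comp₂ (Primrec.dom_bool₂ Bool.and)
      (.of_primrec (Primrec.snd.comp Primrec.snd))
      (OracleComputable.comp hP (.of_primrec
        (Primrec.fst.pair (Primrec.fst.comp Primrec.snd))))) hn
  refine of_bool h fun p a => ?_
  induction n p a with
  | zero => simp
  | succ k ih =>
    simp only [Bool.and_eq_true, ih, Nat.lt_succ_iff_lt_or_eq, or_imp, forall_and, forall_eq,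
      decide_eq_true_eq]

theorem exists_lt {P : Baire → α × ℕ → Prop} {n : Baire → α → ℕ} (hP : OracleDecidable P)
    (hn : OracleComputable n) : OracleDecidable fun p a => ∃ m < n p a, P p (a, m) := by
  simpa using (hP.not.forall_lt hn).not

end OracleDecidable

/-! ### Computable partial functions on Baire space -/

theorem OracleComputable.isComputable {f : Baire → ℕ → ℕ} (hf : OracleComputable f) :
    IsComputable fun p => Part.some (f p) := by
  obtain ⟨φ, hφ, hf⟩ := hf
  refine ⟨_, hφ, fun p q => ?_⟩
  simp only [Part.mem_some_iff, funext_iff]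
  exact forall_congr' fun n => by rw [← show φ p n = f p n from hf p n]

/-- The partial function on Baire space that is computed by a functional. -/
def ofFunctional (Φ : Baire → ℕ →. ℕ) : Baire →. Baire := fun p =>
  ⟨∀ n, (Φ p n).Dom, fun h n => (Φ p n).get (h n)⟩

theorem mem_ofFunctional {Φ : Baire → ℕ →. ℕ} {p q : Baire} :
    q ∈ ofFunctional Φ p ↔ ∀ n, q n ∈ Φ p n :=
  ⟨fun ⟨h, e⟩ n => ⟨h n, congrFun e n⟩,
    fun h => ⟨fun n => (h n).1, funext fun n => (h n).2⟩⟩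

theorem isComputable_ofFunctional {Φ : Baire → ℕ →. ℕ} (hΦ : RecFunctional Φ) :
    IsComputable (ofFunctional Φ) := ⟨Φ, hΦ, fun _ _ => mem_ofFunctional⟩

/-- Unbounded search for a number satisfying `P`, followed by the computation of `f`. -/
theorem exists_isComputable_search {P : Baire → ℕ × ℕ → Prop} {f : Baire → ℕ × ℕ → ℕ}
    (hP : OracleDecidable P) (hf : OracleComputable f) :
    ∃ F : Baire →. Baire, IsComputable F ∧ ∀ p, (∀ n, ∃ v, P p (n, v)) →
      ∃ q ∈ F p, ∀ n, ∃ v, P p (n, v) ∧ q n = f p (n, v) := by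
  classical
  -- Truth is coded by `0`, since `rfind` looks for a zero.
  obtain ⟨φ, hφ, hφP⟩ := hP.ite (OracleComputable.const 0) (OracleComputable.const 1)
  obtain ⟨ψ, hψ, hψf⟩ := hf
  have hid : RecFunctional fun _ n => Part.some n := by
    simpa using RecFunctional.of_natPrimrec Nat.Primrec.id
  have hΦ := hψ.comp (hid.pair hφ.rfind)
  refine ⟨_, isComputable_ofFunctional hΦ, fun p hp => ?_⟩
  have hφ' : ∀ n v, φ p (Nat.pair n v) = 0 ↔ P p (n, v) := fun n v => by
    have h := hφP p (n, v)
    simp only [encode_prod_val, encode_nat] at h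
    rw [h]
    by_cases hnv : P p (n, v) <;> simp [hnv]
  refine ⟨fun n => f p (n, Nat.find (hp n)), mem_ofFunctional.2 fun n => ?_,
    fun n => ⟨_, Nat.find_spec (hp n), rfl⟩⟩
  simp only [Part.map_some, Part.bind_some, Part.bind_map, Part.mem_bind_iff]
  refine ⟨Nat.find (hp n), ?_, by
    rw [Part.mem_some_iff]; exact (hψf p (n, Nat.find (hp n))).symm⟩
  refine Nat.mem_rfind.2 ⟨?_, fun {m} hm => ?_⟩
  · simpa [hφ'] using Nat.find_spec (hp n)
  · simpa [hφ'] using Nat.find_min (hp n) hm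

/-- Only the `oracle` clause has to be replaced. This transports computations on a name `r` to
machines whose oracle is `⟨r, q⟩`. -/
theorem RecFunctional.subst {f : Baire → Baire}
    (hf : RecFunctional fun p n => Part.some (f p n)) {Φ : Baire → ℕ →. ℕ}
    (hΦ : RecFunctional Φ) : RecFunctional fun p => Φ (f p) := by
  induction hΦ with
  | zero => exact .zero
  | succ => exact .succ
  | left => exact .left
  | right => exact .right
  | oracle => exact hf
  | pair _ _ h₁ h₂ => exact h₁.pair h₂
  | comp _ _ h₁ h₂ => exact h₁.comp h₂
  | prec _ _ h₁ h₂ => exact h₁.prec h₂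
  | rfind _ h => exact h.rfind

section Subst

variable {α β : Type} [Primcodable α] [Primcodable β] {f : Baire → Baire}

theorem OracleComputable.subst {g : Baire → α → β} (hg : OracleComputable g)
    (hf : OracleComputable f) : OracleComputable fun p => g (f p) := by
  obtain ⟨φ, hφ, hf⟩ := hf
  obtain ⟨ψ, hψ, hg⟩ := hg
  have : f = φ := funext₂ fun p n => (hf p n).symm
  subst this
  exact ⟨_, hφ.subst hψ, fun p => hg (f p)⟩

theorem OracleDecidable.subst {P : Baire → α → Prop} (hP : OracleDecidable P)
    (hf : OracleComputable f) : OracleDecidable fun p => P (f p) :=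
  OracleComputable.subst hP hf

end Subst

theorem oracleComputable_fstPart : OracleComputable fstPart :=
  .query (.of_primrec Primrec.nat_double)

theorem oracleComputable_sndPart : OracleComputable sndPart :=
  .query (.of_primrec Primrec.nat_double_succ)

theorem OracleComputable.join {f g : Baire → ℕ → ℕ} (hf : OracleComputable f)
    (hg : OracleComputable g) : OracleComputable fun p => Weihrauch.join (f p) (g p) := by
  have h2 : OracleComputable fun _ (n : ℕ) => n / 2 :=
    .of_primrec (Primrec.nat_div.comp Primrec.id (Primrec.const 2))
  exact OracleDecidable.ite (OracleDecidable.of_primrecRel Primrec.eq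
    (.of_primrec (Primrec.nat_mod.comp Primrec.id (Primrec.const 2))) (.const 0))
    (hf.comp h2) (hg.comp h2)

/-! ### Rational arithmetic relative to an oracle -/

/-- A rational-valued function is computed, on codes, by an oracle machine. -/
def OracleRat {α : Type} [Primcodable α] (f : Baire → α → ℚ) : Prop :=
  ∃ g : Baire → α → ℕ, OracleComputable g ∧ ∀ p a, ratEnum (g p a) = f p a

/-- The difference of two rationals, on codes. -/
def ratSubCode (i j : ℕ) : ℕ :=
  Nat.pair
    (Nat.pair (i.unpair.1.unpair.1 * (j.unpair.2 + 1) + j.unpair.1.unpair.2 * (i.unpair.2 + 1))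
      (i.unpair.1.unpair.2 * (j.unpair.2 + 1) + j.unpair.1.unpair.1 * (i.unpair.2 + 1)))
    ((i.unpair.2 + 1) * (j.unpair.2 + 1) - 1)

theorem ratEnum_ratSubCode (i j : ℕ) : ratEnum (ratSubCode i j) = ratEnum i - ratEnum j := by
  simp only [ratSubCode, ratEnum, Nat.unpair_pair]
  generalize i.unpair.1.unpair.1 = a
  generalize i.unpair.1.unpair.2 = a'
  generalize i.unpair.2 = b
  generalize j.unpair.1.unpair.1 = c
  generalize j.unpair.1.unpair.2 = c'
  generalize j.unpair.2 = d
  have hden : (((b + 1) * (d + 1) - 1 : ℕ) : ℚ) + 1 = ((b : ℚ) + 1) * ((d : ℚ) + 1) := by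
    have : (b + 1) * (d + 1) - 1 + 1 = (b + 1) * (d + 1) :=
      Nat.sub_add_cancel (Nat.mul_pos b.succ_pos d.succ_pos)
    exact_mod_cast this
  have hb : ((b : ℚ) + 1) ≠ 0 := by positivity
  have hd : ((d : ℚ) + 1) ≠ 0 := by positivity
  rw [hden]
  push_cast
  field_simp
  ring

theorem primrec_unpair_fst : Primrec fun n : ℕ => n.unpair.1 := Primrec.fst.comp Primrec.unpair

theorem primrec_unpair_snd : Primrec fun n : ℕ => n.unpair.2 := Primrec.snd.comp Primrec.unpair

theorem OracleComputable.unpair_fst {α : Type} [Primcodable α] {n : Baire → α → ℕ}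
    (hn : OracleComputable n) : OracleComputable fun p a => (n p a).unpair.1 :=
  .comp₁ (f := fun n : ℕ => n.unpair.1) primrec_unpair_fst hn

theorem OracleComputable.unpair_snd {α : Type} [Primcodable α] {n : Baire → α → ℕ}
    (hn : OracleComputable n) : OracleComputable fun p a => (n p a).unpair.2 :=
  .comp₁ (f := fun n : ℕ => n.unpair.2) primrec_unpair_snd hn

theorem ratSubCode_primrec : Primrec₂ ratSubCode := by
  have l := primrec_unpair_fst
  have r := primrec_unpair_snd
  have hi : Primrec fun x : ℕ × ℕ => x.1 := Primrec.fst
  have hj : Primrec fun x : ℕ × ℕ => x.2 := Primrec.snd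
  have s : ∀ {f : ℕ × ℕ → ℕ}, Primrec f → Primrec fun x => f x + 1 := fun h =>
    Primrec.succ.comp h
  have hu := Primrec.nat_add.comp
    (Primrec.nat_mul.comp (l.comp (l.comp hi)) (s (r.comp hj)))
    (Primrec.nat_mul.comp (r.comp (l.comp hj)) (s (r.comp hi)))
  have hv := Primrec.nat_add.comp
    (Primrec.nat_mul.comp (r.comp (l.comp hi)) (s (r.comp hj)))
    (Primrec.nat_mul.comp (l.comp (l.comp hj)) (s (r.comp hi)))
  exact Primrec₂.natPair.comp (Primrec₂.natPair.comp hu hv)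
    (Primrec.nat_sub.comp (Primrec.nat_mul.comp (s (r.comp hi)) (s (r.comp hj)))
      (Primrec.const 1))

theorem ratEnum_neg_iff (i : ℕ) : ratEnum i < 0 ↔ i.unpair.1.unpair.1 < i.unpair.1.unpair.2 := by
  have h : (0 : ℚ) < (i.unpair.2 : ℚ) + 1 := by positivity
  rw [ratEnum, div_lt_iff₀ h, zero_mul, sub_neg, Nat.cast_lt]

theorem ratEnum_pair_pair (a b c : ℕ) :
    ratEnum (Nat.pair (Nat.pair a b) c) = ((a : ℚ) - b) / (c + 1) := by
  simp [ratEnum]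

namespace OracleRat

variable {α : Type} [Primcodable α] {f g : Baire → α → ℚ}

theorem of_code {n : Baire → α → ℕ} (hn : OracleComputable n) :
    OracleRat fun p a => ratEnum (n p a) := ⟨n, hn, fun _ _ => rfl⟩

theorem comp {β : Type} [Primcodable β] {h : Baire → β → α} (hf : OracleRat f)
    (hh : OracleComputable h) : OracleRat fun p b => f p (h p b) := by
  obtain ⟨i, hi, hf⟩ := hf
  exact ⟨_, hi.comp hh, fun p b => hf p _⟩

theorem subst {h : Baire → Baire} (hf : OracleRat f)
    (hh : OracleComputable h) : OracleRat fun p => f (h p) := by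
  obtain ⟨i, hi, hf⟩ := hf
  exact ⟨_, hi.subst hh, fun p => hf (h p)⟩

theorem const (q : ℚ) : OracleRat fun _ (_ : α) => q := by
  obtain ⟨n, rfl⟩ := ratEnum_surjective q
  exact of_code (.const n)

theorem sub (hf : OracleRat f) (hg : OracleRat g) : OracleRat fun p a => f p a - g p a := by
  obtain ⟨i, hi, hf⟩ := hf
  obtain ⟨j, hj, hg⟩ := hg
  exact ⟨_, .comp₂ ratSubCode_primrec hi hj, fun p a => by rw [ratEnum_ratSubCode, hf, hg]⟩

theorem add (hf : OracleRat f) (hg : OracleRat g) : OracleRat fun p a => f p a + g p a := by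
  simpa using hf.sub ((const 0).sub hg)

theorem natDiv {m n : Baire → α → ℕ} (hm : OracleComputable m) (hn : OracleComputable n) :
    OracleRat fun p a => (m p a : ℚ) / ((n p a : ℚ) + 1) :=
  ⟨_, .comp₂ Primrec₂.natPair (.comp₂ Primrec₂.natPair hm (.const 0)) hn,
    fun p a => by simp [ratEnum_pair_pair]⟩

theorem nnratEnum {n : Baire → α → ℕ} (hn : OracleComputable n) :
    OracleRat fun p a => nnratEnum (n p a) :=
  natDiv hn.unpair_fst hn.unpair_snd

theorem half_pow {n : Baire → α → ℕ} (hn : OracleComputable n) :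
    OracleRat fun p a => (1 / 2 : ℚ) ^ n p a := by
  have h : Primrec₂ fun a b : ℕ => a ^ b := Primrec₂.unpaired'.1 Nat.Primrec.pow
  -- Denominators have the form `n + 1`, so `2 ^ n` enters as `(2 ^ n - 1) + 1`.
  obtain ⟨g, hg, hgf⟩ := natDiv (.const 1) (OracleComputable.comp₂ Primrec.nat_sub
    (.comp₂ h (.const 2) hn) (.const 1))
  refine ⟨g, hg, fun p a => ?_⟩
  have : ((2 ^ n p a - 1 : ℕ) : ℚ) + 1 = 2 ^ n p a := by
    exact_mod_cast Nat.sub_add_cancel (Nat.one_le_two_pow (n := n p a))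
  simp only [hgf, this]
  simp

theorem abs (hf : OracleRat f) : OracleRat fun p a => |f p a| := by
  obtain ⟨i, hi, hf⟩ := hf
  obtain ⟨j, hj⟩ := ratEnum_surjective 0
  obtain ⟨k, hk, hkf⟩ := nnratEnum (OracleComputable.comp₂ ratDistCode_primrec hi (.const j))
  exact ⟨k, hk, fun p a => by
    simp only [hkf, nnratEnum_ratDistCode, hj, sub_zero, hf]⟩

theorem lt (hf : OracleRat f) (hg : OracleRat g) : OracleDecidable fun p a => f p a < g p a := by
  obtain ⟨i, hi, h⟩ := hf.sub hg
  have := OracleDecidable.of_primrecRel Primrec.nat_lt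
    hi.unpair_fst.unpair_fst hi.unpair_fst.unpair_snd
  simpa only [← ratEnum_neg_iff, h, sub_neg] using this

theorem le (hf : OracleRat f) (hg : OracleRat g) : OracleDecidable fun p a => f p a ≤ g p a := by
  simpa only [not_lt] using (hg.lt hf).not

end OracleRat

/-! ### Names of reals and of basic balls -/

/-- The centre of the basic ball with code `k`. -/
def ballCenter (k : ℕ) : ℚ := ratEnum k.unpair.1

/-- The radius of the basic ball with code `k`. -/
def ballRadius (k : ℕ) : ℚ := nnratEnum k.unpair.2

theorem OracleRat.ballCenter {α : Type} [Primcodable α] {n : Baire → α → ℕ}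
    (hn : OracleComputable n) : OracleRat fun p a => ballCenter (n p a) :=
  .of_code hn.unpair_fst

theorem OracleRat.ballRadius {α : Type} [Primcodable α] {n : Baire → α → ℕ}
    (hn : OracleComputable n) : OracleRat fun p a => ballRadius (n p a) :=
  .nnratEnum hn.unpair_snd

theorem mem_basicBall {k : ℕ} {x : ℝ} :
    x ∈ basicBall realMetric k ↔ |x - ballCenter k| < ballRadius k := Iff.rfl

theorem nnratEnum_zero : nnratEnum 0 = 0 := by simp [nnratEnum]

theorem ratEnum_zero : ratEnum 0 = 0 := by simp [ratEnum]

/-- Makes `0` a harmless filler in a negative name. -/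
theorem basicBall_zero : basicBall realMetric 0 = ∅ := by
  ext x
  simp [mem_basicBall, ballRadius, nnratEnum_zero]

/-- Arbitrarily small basic balls around a real. -/
theorem exists_small_ball (x : ℝ) {ε : ℝ} (hε : 0 < ε) :
    ∃ k, |x - ballCenter k| < ballRadius k ∧ (ballRadius k : ℝ) < ε := by
  obtain ⟨b, hb⟩ := exists_nat_one_div_lt hε
  obtain ⟨n, hn⟩ := realMetric.dense.exists_dist_lt x (ε := 1 / ((b : ℝ) + 1)) (by positivity)
  refine ⟨Nat.pair n (Nat.pair 1 b), ?_, ?_⟩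
  · simpa [ballCenter, ballRadius, nnratEnum, Real.dist_eq, realMetric] using hn
  · simpa [ballRadius, nnratEnum] using hb

theorem names_real_iff {p : Baire} {x : ℝ} : (cauchyRep realMetric).Names p x ↔
    (∀ i j, i ≤ j → |(ratEnum (p i) : ℝ) - ratEnum (p j)| ≤ (1 / 2 : ℝ) ^ i) ∧
      Filter.Tendsto (fun n => (ratEnum (p n) : ℝ)) Filter.atTop (nhds x) := Iff.rfl

theorem abs_sub_le_of_names {p : Baire} {x : ℝ} (h : (cauchyRep realMetric).Names p x) (n : ℕ) :
    |(ratEnum (p n) : ℝ) - x| ≤ (1 / 2 : ℝ) ^ n := by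
  rw [names_real_iff] at h
  exact le_of_tendsto (h.2.const_sub _).abs
    (Filter.eventually_atTop.2 ⟨n, fun j hj => h.1 n j hj⟩)

theorem tendsto_half_pow : Filter.Tendsto (fun n : ℕ => (1 / 2 : ℝ) ^ n) Filter.atTop (nhds 0) :=
  tendsto_pow_atTop_nhds_zero_of_lt_one (by norm_num) (by norm_num)

/-- The extra factor `1 / 2` pays for the triangle inequality through `x` in the Cauchy condition.
-/
theorem names_of_abs_sub_le {p : Baire} {x : ℝ}
    (h : ∀ n, |(ratEnum (p n) : ℝ) - x| ≤ (1 / 2 : ℝ) ^ (n + 1)) :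
    (cauchyRep realMetric).Names p x := by
  rw [names_real_iff]
  refine ⟨fun i j hij => ?_, ?_⟩
  · have h2 : (1 / 2 : ℝ) ^ (j + 1) ≤ (1 / 2 : ℝ) ^ (i + 1) :=
      pow_le_pow_of_le_one (by norm_num) (by norm_num) (by omega)
    have h3 : (1 / 2 : ℝ) ^ (i + 1) = (1 / 2 : ℝ) ^ i / 2 := by ring
    have h4 := abs_sub_le (ratEnum (p i) : ℝ) x (ratEnum (p j))
    rw [abs_sub_comm x] at h4
    linarith [h i, h j]
  · rw [tendsto_iff_dist_tendsto_zero]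
    exact squeeze_zero (fun _ => dist_nonneg) h
      (tendsto_half_pow.comp (Filter.tendsto_add_atTop_nat 1))

/-! ### Names of two-point sets -/

/-- The negative name of the two-point set approximated by the rational sequences `u`, `v`. -/
def negSeq (u v : ℕ → ℚ) : Baire := fun t =>
  if ballRadius t.unpair.1 + (1 / 2) ^ t.unpair.2 ≤ |ballCenter t.unpair.1 - u t.unpair.2| ∧
    ballRadius t.unpair.1 + (1 / 2) ^ t.unpair.2 ≤ |ballCenter t.unpair.1 - v t.unpair.2|
  then t.unpair.1 else 0

/-- The positive name of the two-point set approximated by the rational sequences `u`, `v`;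
`k` is the code of a ball that is known to meet this set. -/
def posSeq (k : ℕ) (u v : ℕ → ℚ) : Baire := fun t =>
  if |ballCenter t.unpair.1 - u t.unpair.2| + (1 / 2) ^ t.unpair.2 < ballRadius t.unpair.1 ∨
    |ballCenter t.unpair.1 - v t.unpair.2| + (1 / 2) ^ t.unpair.2 < ballRadius t.unpair.1
  then t.unpair.1 else k

theorem oracleComputable_negSeq {u v : Baire → ℕ → ℚ} (hu : OracleRat u) (hv : OracleRat v) :
    OracleComputable fun p => negSeq (u p) (v p) := by
  have k : OracleComputable fun _ (t : ℕ) => t.unpair.1 := .of_primrec primrec_unpair_fst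
  have s : OracleComputable fun _ (t : ℕ) => t.unpair.2 := .of_primrec primrec_unpair_snd
  have hr := (OracleRat.ballRadius k).add (OracleRat.half_pow s)
  exact OracleDecidable.ite
    ((hr.le ((OracleRat.ballCenter k).sub (hu.comp s)).abs).and
      (hr.le ((OracleRat.ballCenter k).sub (hv.comp s)).abs)) k (.const 0)

theorem oracleComputable_posSeq (k₀ : ℕ) {u v : Baire → ℕ → ℚ} (hu : OracleRat u)
    (hv : OracleRat v) : OracleComputable fun p => posSeq k₀ (u p) (v p) := by
  have k : OracleComputable fun _ (t : ℕ) => t.unpair.1 := .of_primrec primrec_unpair_fst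
  have s : OracleComputable fun _ (t : ℕ) => t.unpair.2 := .of_primrec primrec_unpair_snd
  have hr := OracleRat.ballRadius k
  have hs := OracleRat.half_pow s
  exact OracleDecidable.ite
    (((((OracleRat.ballCenter k).sub (hu.comp s)).abs.add hs).lt hr).or
      ((((OracleRat.ballCenter k).sub (hv.comp s)).abs.add hs).lt hr)) k (.const k₀)

section TwoPoint

variable {u v : ℕ → ℚ} {x y : ℝ}

theorem radius_le_of_approx (hu : ∀ s, |(u s : ℝ) - x| ≤ (1 / 2) ^ s) {k s : ℕ}
    (h : ballRadius k + (1 / 2) ^ s ≤ |ballCenter k - u s|) :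
    (ballRadius k : ℝ) ≤ |x - ballCenter k| := by
  have h' := (Rat.cast_le (K := ℝ)).2 h
  push_cast at h'
  have := abs_sub_le (ballCenter k : ℝ) x (u s)
  rw [abs_sub_comm _ x, abs_sub_comm x (u s : ℝ)] at this
  linarith [hu s]

theorem lt_radius_of_approx (hu : ∀ s, |(u s : ℝ) - x| ≤ (1 / 2) ^ s) {k s : ℕ}
    (h : |ballCenter k - u s| + (1 / 2) ^ s < ballRadius k) :
    |x - ballCenter k| < ballRadius k := by
  have h' := (Rat.cast_lt (K := ℝ)).2 h
  push_cast at h'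
  have := abs_sub_le x (u s) (ballCenter k : ℝ)
  rw [abs_sub_comm (u s : ℝ) (ballCenter k), abs_sub_comm x (u s : ℝ)] at this
  linarith [hu s]

theorem exists_approx_lt_radius (hu : ∀ s, |(u s : ℝ) - x| ≤ (1 / 2) ^ s) {k : ℕ}
    (h : |x - ballCenter k| < ballRadius k) :
    ∃ s, |ballCenter k - u s| + (1 / 2) ^ s < ballRadius k := by
  obtain ⟨s, hs⟩ := exists_pow_lt_of_lt_one (half_pos (sub_pos.2 h)) (by norm_num : (1 / 2 : ℝ) < 1)
  refine ⟨s, ?_⟩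
  rw [← Rat.cast_lt (K := ℝ)]
  push_cast
  have := abs_sub_le (ballCenter k : ℝ) x (u s)
  rw [abs_sub_comm _ x, abs_sub_comm x (u s : ℝ)] at this
  linarith [hu s]

/-- A ball is listed once some approximation proves that it misses both points. Around any other
point, sufficiently small balls pass this test. -/
theorem negName_negSeq (hu : ∀ s, |(u s : ℝ) - x| ≤ (1 / 2) ^ s)
    (hv : ∀ s, |(v s : ℝ) - y| ≤ (1 / 2) ^ s) : NegName realMetric (negSeq u v) {x, y} := by
  rw [NegName, eq_compl_comm]
  ext z
  simp only [Set.mem_range, Set.iUnion_exists, Set.iUnion_iUnion_eq', Set.mem_iUnion,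
    Set.mem_compl_iff, Set.mem_insert_iff, Set.mem_singleton_iff, not_or]
  constructor
  · rintro ⟨t, ht⟩
    rw [negSeq] at ht
    split_ifs at ht with h
    · rw [mem_basicBall] at ht
      constructor
      · rintro rfl
        linarith [radius_le_of_approx hu h.1]
      · rintro rfl
        linarith [radius_le_of_approx hv h.2]
    · simp [basicBall_zero] at ht
  · rintro ⟨hx, hy⟩
    have hx' := abs_pos.2 (sub_ne_zero.2 hx)
    have hy' := abs_pos.2 (sub_ne_zero.2 hy)
    -- Four errors below `ε` occur: the radius of the ball, the distance of `z` from its centre, and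
    -- `2⁻ˢ` twice.
    obtain ⟨ε, hε, hεx, hεy⟩ : ∃ ε > 0, 4 * ε ≤ |z - x| ∧ 4 * ε ≤ |z - y| :=
      ⟨min |z - x| |z - y| / 4, by positivity, by linarith [min_le_left |z - x| |z - y|],
        by linarith [min_le_right |z - x| |z - y|]⟩
    obtain ⟨k, hk, hkε⟩ := exists_small_ball z hε
    obtain ⟨s, hs⟩ := exists_pow_lt_of_lt_one hε (by norm_num : (1 / 2 : ℝ) < 1)
    have key : ∀ {w : ℕ → ℚ} {a : ℝ}, (∀ s, |(w s : ℝ) - a| ≤ (1 / 2) ^ s) → 4 * ε ≤ |z - a| →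
        ballRadius k + (1 / 2) ^ s ≤ |ballCenter k - w s| := by
      intro w a hw ha
      rw [← Rat.cast_le (K := ℝ)]
      push_cast
      have h1 := abs_sub_le z (ballCenter k) a
      have h2 := abs_sub_le (ballCenter k : ℝ) (w s) a
      linarith [hw s]
    refine ⟨Nat.pair k s, ?_⟩
    have : negSeq u v (Nat.pair k s) = k := by
      simp only [negSeq, Nat.unpair_pair]
      exact if_pos ⟨key hu hεx, key hv hεy⟩
    rw [this, mem_basicBall]
    exact hk

/-- Meeting the set is an open condition, hence visible at a finite stage. The filler `k₀` must
itself meet the set, since a positive name lists no other balls. -/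
theorem posName_posSeq (hu : ∀ s, |(u s : ℝ) - x| ≤ (1 / 2) ^ s)
    (hv : ∀ s, |(v s : ℝ) - y| ≤ (1 / 2) ^ s) {k₀ : ℕ}
    (hk₀ : (basicBall realMetric k₀ ∩ {x, y}).Nonempty) :
    PosName realMetric (posSeq k₀ u v) {x, y} := by
  intro k
  constructor
  · rintro ⟨t, rfl⟩
    rw [posSeq]
    split_ifs with h
    · rcases h with h | h
      · exact ⟨x, lt_radius_of_approx hu h, by simp⟩
      · exact ⟨y, lt_radius_of_approx hv h, by simp⟩
    · exact hk₀
  · rintro ⟨z, hz, rfl | rfl⟩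
    · obtain ⟨s, hs⟩ := exists_approx_lt_radius hu hz
      refine ⟨Nat.pair k s, ?_⟩
      simp only [posSeq, Nat.unpair_pair]
      exact if_pos (Or.inl hs)
    · obtain ⟨s, hs⟩ := exists_approx_lt_radius hv hz
      refine ⟨Nat.pair k s, ?_⟩
      simp only [posSeq, Nat.unpair_pair]
      exact if_pos (Or.inr hs)

end TwoPoint

/-! ### `LLPO` reduces to the projection operator -/

/-- The length of the initial run of zeros of `p`, cut off at `s`. -/
def zeroRun (p : Baire) (s : ℕ) : ℕ :=
  Nat.rec (motive := fun _ => ℕ) 0 (fun m b => if p b = 0 then m + 1 else b) s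

/-- The recursion tests `p` at the current value instead of at the stage, so the value freezes once
it reaches a nonzero entry. -/
theorem zeroRun_spec (p : Baire) (s : ℕ) :
    zeroRun p s ≤ s ∧ (∀ i < zeroRun p s, p i = 0) ∧ (zeroRun p s < s → p (zeroRun p s) ≠ 0) := by
  induction s with
  | zero => simp [zeroRun]
  | succ s ih =>
    obtain ⟨h1, h2, h3⟩ := ih
    have e : zeroRun p (s + 1) = if p (zeroRun p s) = 0 then s + 1 else zeroRun p s := rfl
    rw [e]
    split_ifs with h
    · have hs : zeroRun p s = s := by
        by_contra hne
        exact h3 (by omega) h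
      rw [hs] at h h2
      refine ⟨le_rfl, fun i hi => ?_, fun h => absurd h (lt_irrefl _)⟩
      rcases Nat.lt_succ_iff_lt_or_eq.1 hi with hi | rfl
      · exact h2 i hi
      · exact h
    · exact ⟨by omega, h2, fun _ => h⟩

theorem oracleComputable_zeroRun {f : Baire → Baire} (hf : OracleComputable f) :
    OracleComputable fun p => zeroRun (f p) := by
  have hb : OracleComputable fun _ (x : ℕ × ℕ × ℕ) => x.2.2 :=
    .of_primrec (Primrec.snd.comp Primrec.snd)
  have hm : OracleComputable fun _ (x : ℕ × ℕ × ℕ) => x.2.1 + 1 :=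
    .of_primrec (Primrec.succ.comp (Primrec.fst.comp Primrec.snd))
  exact OracleComputable.nat_rec (g := fun p (x : ℕ × ℕ × ℕ) =>
    if f p x.2.2 = 0 then x.2.1 + 1 else x.2.2) (.const 0)
    (OracleDecidable.ite (.of_primrecRel Primrec.eq (hf.comp hb) (.const 0)) hm hb)
    (.of_primrec Primrec.id)

/-- At stage `s` the power either has reached its limit, or equals `2⁻ˢ` while the limit lies in
`[0, 2⁻ˢ]`. So `a` is computable from `p` although `a = 0` is undecidable. -/
theorem exists_limit_zeroRun (p : Baire) : ∃ a : ℝ, 0 ≤ a ∧ a ≤ 1 ∧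
    (∀ s, |(1 / 2 : ℝ) ^ zeroRun p s - a| ≤ (1 / 2) ^ s) ∧ (a = 0 ↔ ∀ n, p n = 0) := by
  by_cases h : ∀ n, p n = 0
  · refine ⟨0, le_rfl, zero_le_one, fun s => ?_, by simp [h]⟩
    have : zeroRun p s = s := by
      by_contra hne
      exact (zeroRun_spec p s).2.2 (lt_of_le_of_ne (zeroRun_spec p s).1 hne) (h _)
    rw [this, sub_zero, abs_of_nonneg (by positivity)]
  · push Not at h
    classical
    refine ⟨(1 / 2) ^ Nat.find h, by positivity, pow_le_one₀ (by norm_num) (by norm_num),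
      fun s => ?_, ?_⟩
    · obtain ⟨h1, h2, h3⟩ := zeroRun_spec p s
      have hle : zeroRun p s ≤ Nat.find h := by
        by_contra hlt
        exact Nat.find_spec h (h2 _ (not_le.1 hlt))
      rcases h1.lt_or_eq with hs | hs
      · rw [le_antisymm hle (Nat.find_min' h (h3 hs)), sub_self, abs_zero]
        positivity
      · rw [hs] at hle ⊢
        have h4 : (1 / 2 : ℝ) ^ Nat.find h ≤ (1 / 2) ^ s :=
          pow_le_pow_of_le_one (by norm_num) (by norm_num) hle
        rw [abs_of_nonneg (by linarith)]
        have : (0 : ℝ) < (1 / 2) ^ Nat.find h := by positivity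
        linarith
    · exact ⟨fun h0 => absurd h0 (by positivity), fun h0 => absurd (h0 _) (Nat.find_spec h)⟩

theorem llpo_reducible_proj : Reducible LLPO (Proj realMetric) := by
  classical
  set u : Baire → ℕ → ℚ := fun p s => -1 - (1 / 2) ^ zeroRun (fstPart p) s with hu
  set v : Baire → ℕ → ℚ := fun p s => 1 + (1 / 2) ^ zeroRun (sndPart p) s with hv
  have hu' : OracleRat u := (OracleRat.const _).sub
    (.half_pow (oracleComputable_zeroRun oracleComputable_fstPart))
  have hv' : OracleRat v := (OracleRat.const _).add
    (.half_pow (oracleComputable_zeroRun oracleComputable_sndPart))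
  -- The ball of radius `3` around `0`; it contains `-1 - a` because `0 ≤ a ≤ 1`.
  set k₀ : ℕ := Nat.pair 0 (Nat.pair 3 0) with hk₀
  have hK := (OracleComputable.const (α := ℕ) 0).join
    ((oracleComputable_negSeq hu' hv').join (oracleComputable_posSeq k₀ hu' hv'))
  -- Entry `5` of `⟨p, q⟩` is `q 2`, an approximation within `1 / 4` of a real of modulus at least
  -- `1`, so it has the same sign.
  have hH : OracleComputable fun p (_ : ℕ) => if ratEnum (p 5) < 0 then 0 else 1 :=
    OracleDecidable.ite ((OracleRat.of_code (.query (.const 5))).lt (.const 0)) (.const 0) (.const 1)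
  refine ⟨_, _, hH.isComputable, hK.isComputable, fun G hG p x hx hne => ?_⟩
  obtain ⟨x₀, x₁⟩ := x
  obtain ⟨rfl, rfl⟩ : fstPart p = x₀ ∧ sndPart p = x₁ := hx
  obtain ⟨a, ha, ha1, hau, ha0⟩ := exists_limit_zeroRun (fstPart p)
  obtain ⟨b, hb, hb1, hbv, hb0⟩ := exists_limit_zeroRun (sndPart p)
  have hup : ∀ s, |(u p s : ℝ) - (-1 - a)| ≤ (1 / 2) ^ s := fun s => by
    rw [hu]
    push_cast
    rw [show (-1 - (1 / 2 : ℝ) ^ zeroRun (fstPart p) s - (-1 - a)) =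
      -((1 / 2 : ℝ) ^ zeroRun (fstPart p) s - a) by ring, abs_neg]
    exact hau s
  have hvp : ∀ s, |(v p s : ℝ) - (1 + b)| ≤ (1 / 2) ^ s := fun s => by
    rw [hv]
    push_cast
    rw [add_sub_add_left_eq_sub]
    exact hbv s
  let A : NonemptyClosed ℝ := ⟨{-1 - a, 1 + b}, (Set.toFinite _).isClosed, Set.insert_nonempty _ _⟩
  have hA : (prodRep (cauchyRep realMetric) (totalRep realMetric)).Names
      (join (fun _ => 0) (join (negSeq (u p) (v p)) (posSeq k₀ (u p) (v p)))) (0, A) := by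
    refine ⟨?_, ?_, ?_⟩
    · rw [fstPart_join]
      refine names_of_abs_sub_le fun n => ?_
      simp [ratEnum_zero]
    · rw [sndPart_join, fstPart_join]
      exact negName_negSeq hup hvp
    · rw [sndPart_join, sndPart_join]
      refine posName_posSeq hup hvp ⟨-1 - a, ?_, by simp⟩
      rw [mem_basicBall, abs_lt]
      simp only [hk₀, ballCenter, ballRadius, nnratEnum, Nat.unpair_pair, ratEnum_zero]
      norm_num
      constructor <;> linarith
  obtain ⟨y₀, hy₀, hy₀d⟩ := A.2.1.exists_infDist_eq_dist A.2.2 0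
  obtain ⟨q, hq, y, hy, hqy⟩ := hG _ _ hA ⟨y₀, hy₀, hy₀d.symm⟩
  change ℝ at y
  change y ∈ A.1 ∧ dist 0 y = Metric.infDist 0 A.1 at hy
  change (cauchyRep realMetric).Names q y at hqy
  obtain ⟨hyA, hyd⟩ := hy
  refine ⟨_, Part.mem_bind (Part.mem_some _) (Part.mem_bind hq (Part.mem_some _)), ?_⟩
  have hq5 : join p q 5 = q 2 := congrFun (sndPart_join p q) 2
  have hq2 := abs_le.1 (abs_sub_le_of_names hqy 2)
  obtain ⟨i, hi⟩ := hne
  change Fin 2 at i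
  have hdisj := hi.1
  have hab : a = 0 ∨ b = 0 := by
    have hi2 := hi.2
    fin_cases i
    · exact Or.inl (ha0.2 hi2)
    · exact Or.inr (hb0.2 hi2)
  have hle : ∀ z ∈ A.1, |y| ≤ |z| := fun z hz => by
    have h1 := Metric.infDist_le_dist_of_mem (x := (0 : ℝ)) hz
    rw [← hyd] at h1
    simpa [Real.dist_eq] using h1
  simp only [hq5]
  rcases (show y = -1 - a ∨ y = 1 + b from hyA) with rfl | rfl
  · have hneg : ratEnum (q 2) < 0 := by
      have : (ratEnum (q 2) : ℝ) < 0 := by norm_num at hq2; linarith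
      exact_mod_cast this
    -- Minimality gives `a ≤ b`; both are nonnegative and one of them vanishes, so `a = 0`.
    have hle' := hle (1 + b) (Or.inr rfl)
    rw [abs_of_nonneg (a := 1 + b) (by linarith), abs_of_nonpos (by linarith)] at hle'
    have ha' : a = 0 := by rcases hab with h | h <;> linarith
    exact ⟨(0 : Fin 2), ⟨hdisj, ha0.1 ha'⟩, by simp [twoRep, LLPO, hneg]⟩
  · have hpos : ¬ ratEnum (q 2) < 0 := by
      have : 0 < (ratEnum (q 2) : ℝ) := by norm_num at hq2; linarith
      exact not_lt.2 (le_of_lt (by exact_mod_cast this))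
    have hle' := hle (-1 - a) (Or.inl rfl)
    rw [abs_of_nonneg (a := 1 + b) (by linarith), abs_of_nonpos (by linarith)] at hle'
    have hb' : b = 0 := by rcases hab with h | h <;> linarith
    exact ⟨(1 : Fin 2), ⟨hdisj, hb0.1 hb'⟩, by simp [twoRep, LLPO, hpos]⟩

/-! ### Approximating the distance of a point to a closed set -/

/-- The approximation of precision `2⁻ʷ` to the point named by the first half of `r`. -/
def pointApprox (r : Baire) (w : ℕ) : ℚ := ratEnum (fstPart r w)

/-- The balls in the complement of the closed set named by the second half of `r`. -/
def negBall (r : Baire) (i : ℕ) : ℕ := fstPart (sndPart r) i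

/-- The balls meeting the closed set named by the second half of `r`. -/
def posBall (r : Baire) (i : ℕ) : ℕ := sndPart (sndPart r) i

/-- The lower bound for the distance that is certified by `GridCovered`. -/
def distLower (w m : ℕ) : ℚ := (m : ℚ) / ((w : ℚ) + 1) - (1 / 2) ^ w

/-- The upper bound for the distance given by the `i`-th ball that meets the set. -/
def distUpper (r : Baire) (w i : ℕ) : ℚ :=
  |pointApprox r w - ballCenter (posBall r i)| + ballRadius (posBall r i) + (1 / 2) ^ w

/-- A grid of mesh `1 / (w + 1)` and radius `m / (w + 1)` around the point. -/
def gridPoint (r : Baire) (w m j : ℕ) : ℚ :=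
  pointApprox r w + (j : ℚ) / ((w : ℚ) + 1) - (m : ℚ) / ((w : ℚ) + 1)

/-- Each cell of the grid lies in one of the first `w` balls of the negative name. -/
def GridCovered (r : Baire) (w m : ℕ) : Prop := ∀ j < 2 * m, ∃ i < w,
  |gridPoint r w m j - ballCenter (negBall r i)| + ((1 : ℕ) : ℚ) / ((w : ℚ) + 1) ≤
    ballRadius (negBall r i)

/-- A bound for the error of approximating the point by `pointApprox` and its distance to the set
by `distLower`. -/
def approxError (r : Baire) (w m i : ℕ) : ℚ := distUpper r w i - distLower w m + (1 / 2) ^ w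

/-- The approximation to the left (`b = 0`) or right (`b ≠ 0`) candidate for the projection. -/
def candidateApprox (r : Baire) (b w m : ℕ) : ℚ :=
  if b = 0 then pointApprox r w - distLower w m else pointApprox r w + distLower w m

section Computability

variable {α : Type} [Primcodable α] {w m i j b : Baire → α → ℕ}

theorem oracleRat_pointApprox (hw : OracleComputable w) :
    OracleRat fun r a => pointApprox r (w r a) :=
  .of_code (oracleComputable_fstPart.comp hw)

theorem oracleComputable_negBall (hi : OracleComputable i) :
    OracleComputable fun r a => negBall r (i r a) :=
  (oracleComputable_fstPart.subst oracleComputable_sndPart).comp hi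

theorem oracleComputable_posBall (hi : OracleComputable i) :
    OracleComputable fun r a => posBall r (i r a) :=
  (oracleComputable_sndPart.subst oracleComputable_sndPart).comp hi

theorem oracleRat_distLower (hw : OracleComputable w) (hm : OracleComputable m) :
    OracleRat fun r a => distLower (w r a) (m r a) :=
  (OracleRat.natDiv hm hw).sub (.half_pow hw)

theorem oracleRat_distUpper (hw : OracleComputable w) (hi : OracleComputable i) :
    OracleRat fun r a => distUpper r (w r a) (i r a) :=
  ((((oracleRat_pointApprox hw).sub (.ballCenter (oracleComputable_posBall hi))).abs).add
    (.ballRadius (oracleComputable_posBall hi))).add (.half_pow hw)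

theorem oracleRat_gridPoint (hw : OracleComputable w) (hm : OracleComputable m)
    (hj : OracleComputable j) : OracleRat fun r a => gridPoint r (w r a) (m r a) (j r a) :=
  ((oracleRat_pointApprox hw).add (.natDiv hj hw)).sub (.natDiv hm hw)

theorem oracleRat_approxError (hw : OracleComputable w) (hm : OracleComputable m)
    (hi : OracleComputable i) : OracleRat fun r a => approxError r (w r a) (m r a) (i r a) :=
  ((oracleRat_distUpper hw hi).sub (oracleRat_distLower hw hm)).add (.half_pow hw)

theorem OracleRat.ite {P : Baire → α → Prop} [∀ p a, Decidable (P p a)] {f g : Baire → α → ℚ}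
    (hP : OracleDecidable P) (hf : OracleRat f) (hg : OracleRat g) :
    OracleRat fun p a => if P p a then f p a else g p a := by
  obtain ⟨k, hk, hkf⟩ := hf
  obtain ⟨l, hl, hlg⟩ := hg
  refine ⟨_, hP.ite hk hl, fun p a => ?_⟩
  by_cases h : P p a <;> simp [h, hkf, hlg]

theorem oracleRat_candidateApprox (hb : OracleComputable b) (hw : OracleComputable w)
    (hm : OracleComputable m) :
    OracleRat fun r a => candidateApprox r (b r a) (w r a) (m r a) :=
  OracleRat.ite (.of_primrecRel Primrec.eq hb (.const 0))
    ((oracleRat_pointApprox hw).sub (oracleRat_distLower hw hm))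
    ((oracleRat_pointApprox hw).add (oracleRat_distLower hw hm))

theorem oracleDecidable_gridCovered (hw : OracleComputable w) (hm : OracleComputable m) :
    OracleDecidable fun r a => GridCovered r (w r a) (m r a) := by
  have ha : OracleComputable fun _ (x : α × ℕ) => x.1 := .of_primrec Primrec.fst
  have ha' : OracleComputable fun _ (x : (α × ℕ) × ℕ) => x.1.1 :=
    .of_primrec (Primrec.fst.comp Primrec.fst)
  have hj : OracleComputable fun _ (x : (α × ℕ) × ℕ) => x.1.2 :=
    .of_primrec (Primrec.snd.comp Primrec.fst)
  have hi := oracleComputable_negBall (i := fun _ (x : (α × ℕ) × ℕ) => x.2)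
    (.of_primrec Primrec.snd)
  have hw' := hw.comp ha'
  exact OracleDecidable.forall_lt (OracleDecidable.exists_lt
    ((((oracleRat_gridPoint hw' (hm.comp ha') hj).sub (.ballCenter hi)).abs.add
      (.natDiv (.const 1) hw')).le (.ballRadius hi)) (hw.comp ha))
    (.comp₁ Primrec.nat_double hm)

end Computability

section Approximation

variable {r : Baire} {x : ℝ} {A : Set ℝ}

theorem notMem_of_negName {p : Baire} (hA : NegName realMetric p A) {i : ℕ} {z : ℝ}
    (hz : |z - ballCenter (p i)| < ballRadius (p i)) : z ∉ A := by
  rw [hA, Set.mem_compl_iff, not_not]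
  exact Set.mem_biUnion (Set.mem_range_self i) hz

theorem exists_ball_of_notMem {p : Baire} (hA : NegName realMetric p A) {z : ℝ} (hz : z ∉ A) :
    ∃ i, |z - ballCenter (p i)| < ballRadius (p i) := by
  rw [hA, Set.mem_compl_iff, not_not] at hz
  obtain ⟨_, ⟨i, rfl⟩, hi⟩ := Set.mem_iUnion₂.1 hz
  exact ⟨i, hi⟩

/-- The covered cells fill the interval of radius `m / (w + 1)` around the approximate centre, so
this interval misses `A`; moving the centre to `x` costs `2⁻ʷ`. -/
theorem distLower_le_infDist (hx : (cauchyRep realMetric).Names (fstPart r) x)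
    (hA : NegName realMetric (fstPart (sndPart r)) A) (hne : A.Nonempty) {w m : ℕ}
    (hc : GridCovered r w m) : (distLower w m : ℝ) ≤ Metric.infDist x A := by
  rw [Metric.le_infDist hne]
  intro y hy
  by_contra hlt
  rw [not_le, Real.dist_eq, distLower] at hlt
  push_cast at hlt
  have hw : (0 : ℝ) < (w : ℝ) + 1 := by positivity
  have hxw : |(pointApprox r w : ℝ) - x| ≤ (1 / 2) ^ w := abs_sub_le_of_names hx w
  have h1 := abs_sub_le (pointApprox r w : ℝ) x y
  have h2 := abs_lt.1 (lt_of_le_of_lt h1 (by linarith) :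
    |(pointApprox r w : ℝ) - y| < (m : ℝ) / ((w : ℝ) + 1))
  -- The position of `y` in units of the mesh, counted from the left end of the grid; its floor is
  -- the cell containing `y`.
  set t : ℝ := (y - pointApprox r w) * ((w : ℝ) + 1) + m with ht
  have hty : y = pointApprox r w + t / ((w : ℝ) + 1) - (m : ℝ) / ((w : ℝ) + 1) := by
    rw [ht]
    field_simp
    ring
  have ht0 : 0 < t := by
    have := (lt_div_iff₀ hw).1 h2.2
    rw [ht]
    linarith
  have ht1 : t < 2 * m := by
    have := (lt_div_iff₀ hw).1 (neg_lt.1 h2.1)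
    rw [ht]
    linarith
  have hj1 := Nat.floor_le ht0.le
  have hj2 := Nat.lt_floor_add_one t
  obtain ⟨i, -, hi⟩ := hc ⌊t⌋₊ (by
    rw [← Nat.cast_lt (α := ℝ)]
    push_cast
    linarith)
  have hi' := (Rat.cast_le (K := ℝ)).2 hi
  have hg : |y - gridPoint r w m ⌊t⌋₊| < 1 / ((w : ℝ) + 1) := by
    have e : y - (gridPoint r w m ⌊t⌋₊ : ℝ) = (t - ⌊t⌋₊) / ((w : ℝ) + 1) := by
      rw [gridPoint]
      push_cast
      rw [sub_div]
      linarith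
    rw [e, abs_of_nonneg (div_nonneg (by linarith) hw.le)]
    exact div_lt_div_of_pos_right (by linarith) hw
  refine notMem_of_negName hA (i := i) ?_ hy
  push_cast at hi'
  have := abs_sub_le y (gridPoint r w m ⌊t⌋₊ : ℝ) (ballCenter (negBall r i))
  change |y - ballCenter (negBall r i)| < ballRadius (negBall r i)
  linarith

theorem infDist_le_distUpper (hx : (cauchyRep realMetric).Names (fstPart r) x)
    (hA : PosName realMetric (sndPart (sndPart r)) A) (w i : ℕ) :
    Metric.infDist x A ≤ distUpper r w i := by
  obtain ⟨z, hz, hzA⟩ := (hA (posBall r i)).1 ⟨i, rfl⟩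
  rw [mem_basicBall] at hz
  have hxw : |(pointApprox r w : ℝ) - x| ≤ (1 / 2) ^ w := abs_sub_le_of_names hx w
  have h1 := Metric.infDist_le_dist_of_mem (x := x) hzA
  rw [Real.dist_eq] at h1
  have h2 := abs_sub_le x (pointApprox r w) z
  have h3 := abs_sub_le (pointApprox r w : ℝ) (ballCenter (posBall r i)) z
  rw [abs_sub_comm x (pointApprox r w : ℝ)] at h2
  rw [abs_sub_comm (ballCenter (posBall r i) : ℝ) z] at h3
  rw [distUpper]
  push_cast
  linarith

/-- The distance lies between `distLower` and `distUpper`, so their gap bounds the error. The bound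
is a rational computed from the name, hence a machine can search until it is small. -/
theorem abs_sub_add_abs_sub_le_approxError (hx : (cauchyRep realMetric).Names (fstPart r) x)
    (hN : NegName realMetric (fstPart (sndPart r)) A)
    (hP : PosName realMetric (sndPart (sndPart r)) A) (hne : A.Nonempty) {w m : ℕ} (i : ℕ)
    (hc : GridCovered r w m) :
    |(pointApprox r w : ℝ) - x| + |(distLower w m : ℝ) - Metric.infDist x A| ≤
      approxError r w m i := by
  have h1 := distLower_le_infDist hx hN hne hc
  have h2 := infDist_le_distUpper hx hP w i
  have h3 : |(pointApprox r w : ℝ) - x| ≤ (1 / 2) ^ w := abs_sub_le_of_names hx w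
  rw [abs_of_nonpos (sub_nonpos.2 h1), approxError]
  push_cast
  linarith

/-- A compact set disjoint from `A` is covered by finitely many balls of a negative name of `A`,
uniformly away from their boundaries. -/
theorem exists_uniform_cover {p : Baire} (hA : NegName realMetric p A) {K : Set ℝ}
    (hK : IsCompact K) (hKA : Disjoint K A) : ∃ w₀, ∀ w ≥ w₀, ∀ z ∈ K, ∃ i < w,
      |z - ballCenter (p i)| + 1 / ((w : ℝ) + 1) ≤ ballRadius (p i) := by
  -- As `w` grows, more balls are allowed and the margin shrinks, so these open sets increase and
  -- compactness yields a single `w`.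
  set V : ℕ → Set ℝ := fun w =>
    ⋃ i < w, {z | |z - ballCenter (p i)| + 1 / ((w : ℝ) + 1) < ballRadius (p i)} with hV
  have hmem : ∀ w z, z ∈ V w ↔
      ∃ i < w, |z - ballCenter (p i)| + 1 / ((w : ℝ) + 1) < ballRadius (p i) := by
    intro w z
    simp [hV]
  have hmono : Monotone V := by
    intro w w' hww z hz
    obtain ⟨i, hi, h⟩ := (hmem w z).1 hz
    refine (hmem w' z).2 ⟨i, hi.trans_le hww, lt_of_le_of_lt ?_ h⟩
    have : (w : ℝ) ≤ w' := by exact_mod_cast hww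
    gcongr
  obtain ⟨w₀, hw₀⟩ := hK.elim_directed_cover V
    (fun w => isOpen_biUnion fun i _ => isOpen_lt (by fun_prop) continuous_const)
    (fun z hz => by
      obtain ⟨i, hi⟩ := exists_ball_of_notMem hA (Set.disjoint_left.1 hKA hz)
      obtain ⟨n, hn⟩ := exists_nat_one_div_lt (sub_pos.2 hi)
      refine Set.mem_iUnion.2 ⟨max n (i + 1), (hmem _ z).2 ⟨i, by omega, ?_⟩⟩
      have h1 : 1 / (((max n (i + 1) : ℕ) : ℝ) + 1) ≤ 1 / ((n : ℝ) + 1) := by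
        have : (n : ℝ) ≤ (max n (i + 1) : ℕ) := by exact_mod_cast le_max_left _ _
        gcongr
      linarith) hmono.directed_le
  refine ⟨w₀, fun w hw z hz => ?_⟩
  obtain ⟨i, hi, h⟩ := (hmem w z).1 (hmono hw (hw₀ hz))
  exact ⟨i, hi, h.le⟩

/-- Termination of the search: the certified lower and upper bounds come arbitrarily close. -/
theorem exists_approxError_lt (hx : (cauchyRep realMetric).Names (fstPart r) x)
    (hN : NegName realMetric (fstPart (sndPart r)) A)
    (hP : PosName realMetric (sndPart (sndPart r)) A) (hne : A.Nonempty) {ε : ℝ} (hε : 0 < ε) :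
    ∃ w m i, GridCovered r w m ∧ (approxError r w m i : ℝ) < ε := by
  set d := Metric.infDist x A with hd
  -- The upper bound, with the three terms `2⁻ʷ` of `approxError`, stays below `d + 7δ`, and `m / (w
  -- + 1)` exceeds `d - 3δ`.
  obtain ⟨δ, hδ, hδε⟩ : ∃ δ > 0, 10 * δ ≤ ε := ⟨ε / 10, by positivity, by linarith⟩
  obtain ⟨y, hyA, hy⟩ := (Metric.infDist_lt_iff hne).1 (lt_add_of_pos_right d hδ)
  rw [Real.dist_eq] at hy
  obtain ⟨k, hk, hkδ⟩ := exists_small_ball y hδ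
  obtain ⟨i, rfl⟩ := (hP k).2 ⟨y, hk, hyA⟩
  obtain ⟨w₀, hw₀⟩ := exists_uniform_cover hN (isCompact_closedBall x (d - δ))
    (Set.disjoint_left.2 fun z hz hzA => by
      have h1 := Metric.infDist_le_dist_of_mem (x := x) hzA
      rw [Metric.mem_closedBall, dist_comm] at hz
      linarith)
  obtain ⟨w, ⟨hwp, hwi⟩, hww⟩ := ((tendsto_half_pow.eventually_lt_const hδ).and
    ((tendsto_one_div_add_atTop_nhds_zero_nat (𝕜 := ℝ)).eventually_lt_const hδ)).and
    (Filter.eventually_ge_atTop w₀) |>.exists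
  have hw : (0 : ℝ) < (w : ℝ) + 1 := by positivity
  have hxw : |(pointApprox r w : ℝ) - x| ≤ (1 / 2) ^ w := abs_sub_le_of_names hx w
  -- The largest grid radius, in units of the mesh, for which the grid around the approximate point
  -- stays in the closed ball of radius `d - δ` around `x`. If `t < 0`, the floor is `0` and there
  -- is no cell to cover.
  set t : ℝ := (d - δ - (1 / 2) ^ w) * ((w : ℝ) + 1) with ht
  refine ⟨w, ⌊t⌋₊, i, fun j hj => ?_, ?_⟩
  · have ht0 : 0 ≤ t := by
      by_contra h
      rw [Nat.floor_of_nonpos (not_le.1 h).le] at hj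
      omega
    have hm : (⌊t⌋₊ : ℝ) / ((w : ℝ) + 1) ≤ d - δ - (1 / 2) ^ w := by
      rw [div_le_iff₀ hw]
      exact Nat.floor_le ht0
    obtain ⟨l, hl, h⟩ := hw₀ w hww (gridPoint r w ⌊t⌋₊ j) (by
      rw [Metric.mem_closedBall, Real.dist_eq]
      have h1 : |(gridPoint r w ⌊t⌋₊ j : ℝ) - pointApprox r w| ≤ (⌊t⌋₊ : ℝ) / ((w : ℝ) + 1) := by
        have e : (gridPoint r w ⌊t⌋₊ j : ℝ) - pointApprox r w =
            ((j : ℝ) - ⌊t⌋₊) / ((w : ℝ) + 1) := by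
          rw [gridPoint]
          push_cast
          ring
        rw [e, abs_div, abs_of_pos hw]
        have hj' : (j : ℝ) < 2 * (⌊t⌋₊ : ℝ) := by exact_mod_cast hj
        gcongr
        rw [abs_le]
        constructor <;> linarith [(Nat.cast_nonneg j : (0 : ℝ) ≤ j)]
      have h2 := abs_sub_le (gridPoint r w ⌊t⌋₊ j : ℝ) (pointApprox r w) x
      linarith)
    refine ⟨l, hl, ?_⟩
    rw [← Rat.cast_le (K := ℝ)]
    push_cast
    exact h
  · have hm : d - δ - (1 / 2) ^ w - 1 / ((w : ℝ) + 1) ≤ (⌊t⌋₊ : ℝ) / ((w : ℝ) + 1) := by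
      have h1 := Nat.lt_floor_add_one t
      rw [sub_le_iff_le_add, ← add_div, le_div_iff₀ hw]
      exact h1.le
    have h1 := abs_sub_le (pointApprox r w : ℝ) x (ballCenter (posBall r i))
    have h2 := abs_sub_le x y (ballCenter (posBall r i))
    change |y - ballCenter (posBall r i)| < ballRadius (posBall r i) at hk
    change (ballRadius (posBall r i) : ℝ) < δ at hkδ
    rw [approxError, distUpper, distLower]
    push_cast
    linarith

/-- The left (`b = 0`) or right (`b ≠ 0`) candidate for the projection of `x` onto `A`. -/
noncomputable def candidate (x : ℝ) (A : Set ℝ) (b : ℕ) : ℝ :=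
  if b = 0 then x - Metric.infDist x A else x + Metric.infDist x A

theorem dist_candidate (x : ℝ) (A : Set ℝ) (b : ℕ) :
    dist x (candidate x A b) = Metric.infDist x A := by
  rw [candidate, Real.dist_eq]
  split_ifs
  · rw [sub_sub_cancel, abs_of_nonneg Metric.infDist_nonneg]
  · rw [sub_add_cancel_left, abs_neg, abs_of_nonneg Metric.infDist_nonneg]

theorem candidate_mem (hA : IsClosed A) (hne : A.Nonempty) (x : ℝ) :
    candidate x A 0 ∈ A ∨ candidate x A 1 ∈ A := by
  obtain ⟨y, hy, h⟩ := hA.exists_infDist_eq_dist hne x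
  rw [Real.dist_eq] at h
  rcases le_total y x with hyx | hyx
  · left
    rw [abs_of_nonneg (by linarith)] at h
    rwa [candidate, if_pos rfl, h, sub_sub_cancel]
  · right
    rw [abs_of_nonpos (by linarith)] at h
    rwa [candidate, if_neg one_ne_zero, h, neg_sub, add_sub_cancel]

theorem abs_candidateApprox_sub_le (hx : (cauchyRep realMetric).Names (fstPart r) x)
    (hN : NegName realMetric (fstPart (sndPart r)) A)
    (hP : PosName realMetric (sndPart (sndPart r)) A) (hne : A.Nonempty) {w m : ℕ} (b i : ℕ)
    (hc : GridCovered r w m) :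
    |(candidateApprox r b w m : ℝ) - candidate x A b| ≤ approxError r w m i := by
  refine le_trans ?_ (abs_sub_add_abs_sub_le_approxError hx hN hP hne i hc)
  rw [candidateApprox, candidate]
  split_ifs
  · push_cast
    rw [sub_sub_sub_comm]
    exact abs_sub _ _
  · push_cast
    rw [add_sub_add_comm]
    exact abs_add_le _ _

/-- `v` codes a certificate that the candidate `b` does not belong to the set. -/
def Refutes (r : Baire) (b v : ℕ) : Prop :=
  GridCovered r v.unpair.1 v.unpair.2.unpair.1 ∧
    |candidateApprox r b v.unpair.1 v.unpair.2.unpair.1 -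
        ballCenter (negBall r v.unpair.2.unpair.2.unpair.2)| +
      approxError r v.unpair.1 v.unpair.2.unpair.1 v.unpair.2.unpair.2.unpair.1 <
    ballRadius (negBall r v.unpair.2.unpair.2.unpair.2)

theorem oracleDecidable_refutes (b : ℕ) : OracleDecidable fun r v => Refutes r b v := by
  have hv : OracleComputable fun _ (v : ℕ) => v := .of_primrec Primrec.id
  have hw := hv.unpair_fst
  have hm := hv.unpair_snd.unpair_fst
  have hl := oracleComputable_negBall hv.unpair_snd.unpair_snd.unpair_snd
  exact (oracleDecidable_gridCovered hw hm).and
    ((((oracleRat_candidateApprox (.const b) hw hm).sub (.ballCenter hl)).abs.add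
      (oracleRat_approxError hw hm hv.unpair_snd.unpair_snd.unpair_fst)).lt (.ballRadius hl))

/-- The complement of `A` is the union of the listed open balls, so a candidate outside `A` lies
strictly inside one of them, and a good enough approximation shows this. -/
theorem exists_refutes_iff (hx : (cauchyRep realMetric).Names (fstPart r) x)
    (hN : NegName realMetric (fstPart (sndPart r)) A)
    (hP : PosName realMetric (sndPart (sndPart r)) A) (hne : A.Nonempty) (b : ℕ) :
    (∃ v, Refutes r b v) ↔ candidate x A b ∉ A := by
  constructor
  · rintro ⟨v, hc, hv⟩
    have h1 := abs_candidateApprox_sub_le hx hN hP hne b v.unpair.2.unpair.2.unpair.1 hc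
    have h2 := (Rat.cast_lt (K := ℝ)).2 hv
    push_cast at h2
    rw [abs_sub_comm] at h1
    refine notMem_of_negName hN (i := v.unpair.2.unpair.2.unpair.2) ?_
    have h3 := abs_sub_le (candidate x A b)
      (candidateApprox r b v.unpair.1 v.unpair.2.unpair.1 : ℝ)
      (ballCenter (negBall r v.unpair.2.unpair.2.unpair.2))
    change |candidate x A b - ballCenter (negBall r v.unpair.2.unpair.2.unpair.2)| <
      ballRadius (negBall r v.unpair.2.unpair.2.unpair.2)
    linarith
  · intro h
    obtain ⟨l, hl⟩ := exists_ball_of_notMem hN h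
    change |candidate x A b - ballCenter (negBall r l)| < ballRadius (negBall r l) at hl
    -- Half the gap, because the error counts twice: in the position of the approximation and in the
    -- margin of the certificate.
    obtain ⟨w, m, i, hc, he⟩ := exists_approxError_lt hx hN hP hne (half_pos (sub_pos.2 hl))
    refine ⟨Nat.pair w (Nat.pair m (Nat.pair i l)), ?_⟩
    simp only [Refutes, Nat.unpair_pair]
    refine ⟨hc, ?_⟩
    rw [← Rat.cast_lt (K := ℝ)]
    push_cast
    have h1 := abs_candidateApprox_sub_le hx hN hP hne b i hc
    have h2 := abs_sub_le (candidateApprox r b w m : ℝ) (candidate x A b)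
      (ballCenter (negBall r l))
    linarith

end Approximation

/-! ### The projection operator reduces to `LLPO` -/

open Classical in
/-- The sequence that is `1` at the least certificate refuting the candidate `b`, and `0`
elsewhere. -/
noncomputable def firstRefutation (r : Baire) (b : ℕ) : Baire := fun v =>
  if Refutes r b v ∧ ∀ v' < v, ¬ Refutes r b v' then 1 else 0

theorem oracleComputable_firstRefutation (b : ℕ) :
    OracleComputable fun r => firstRefutation r b := by
  classical
  exact OracleDecidable.ite ((oracleDecidable_refutes b).and
    (OracleDecidable.forall_lt (P := fun r (x : ℕ × ℕ) => ¬ Refutes r b x.2)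
      (((oracleDecidable_refutes b).comp (.of_primrec Primrec.snd)).not)
      (.of_primrec Primrec.id))) (.const 1) (.const 0)

theorem firstRefutation_ne_zero_iff {r : Baire} {b v : ℕ} : firstRefutation r b v ≠ 0 ↔
    Refutes r b v ∧ ∀ v' < v, ¬ Refutes r b v' := by
  simp [firstRefutation]

theorem firstRefutation_eq_zero_iff {r : Baire} {b : ℕ} :
    (∀ v, firstRefutation r b v = 0) ↔ ¬ ∃ v, Refutes r b v := by
  classical
  constructor
  · rintro h ⟨v, hv⟩
    have hex : ∃ v, Refutes r b v := ⟨v, hv⟩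
    exact firstRefutation_ne_zero_iff.2
      ⟨Nat.find_spec hex, fun _ => Nat.find_min hex⟩ (h (Nat.find hex))
  · intro h v
    by_contra hv
    exact h ⟨v, (firstRefutation_ne_zero_iff.1 hv).1⟩

theorem firstRefutation_pair (r : Baire) (j : Fin 2) (n : ℕ) :
    ![firstRefutation r 0, firstRefutation r 1] j n = firstRefutation r j n := by
  fin_cases j <;> rfl

theorem proj_reducible_llpo : Reducible (Proj realMetric) LLPO := by
  have hK := (oracleComputable_firstRefutation 0).join (oracleComputable_firstRefutation 1)
  -- Output `n` is searched to precision `2⁻⁽ⁿ⁺¹⁾`, as `names_of_abs_sub_le` demands.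
  have hn : OracleComputable fun _ (x : ℕ × ℕ) => x.1 + 1 :=
    .of_primrec (Primrec.succ.comp Primrec.fst)
  have hv : OracleComputable fun _ (x : ℕ × ℕ) => x.2 := .of_primrec Primrec.snd
  have hw := hv.unpair_fst
  have hm := hv.unpair_snd.unpair_fst
  have hi := hv.unpair_snd.unpair_snd
  have hT := ((oracleDecidable_gridCovered hw hm).and
    ((oracleRat_approxError hw hm hi).le (.half_pow hn))).subst oracleComputable_fstPart
  -- The oracle is `⟨r, q⟩`, with `q` an answer of `LLPO`: its first half is `r`, and its entry `1`
  -- is `q 0`, the chosen side.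
  obtain ⟨c, hc, hcand⟩ : ∃ c : Baire → ℕ × ℕ → ℕ, OracleComputable c ∧ ∀ p y,
      ratEnum (c p y) =
        candidateApprox (fstPart p) (p 1) y.2.unpair.1 y.2.unpair.2.unpair.1 := by
    have hside : ∀ b : ℕ, OracleRat fun p (y : ℕ × ℕ) =>
        candidateApprox (fstPart p) b y.2.unpair.1 y.2.unpair.2.unpair.1 := fun b =>
      (oracleRat_candidateApprox (.const b) hw hm).subst oracleComputable_fstPart
    obtain ⟨c, hc, h⟩ := OracleRat.ite
      (P := fun p (_ : ℕ × ℕ) => p 1 = 0) (.of_primrecRel Primrec.eq (.query (.const 1)) (.const 0))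
      (hside 0) (hside 1)
    refine ⟨c, hc, fun p y => ?_⟩
    rw [h]
    by_cases h1 : p 1 = 0 <;> simp [h1, candidateApprox]
  obtain ⟨H, hH, hHspec⟩ := exists_isComputable_search hT hc
  refine ⟨H, _, hH, hK.isComputable, fun G hG r z hz hne => ?_⟩
  obtain ⟨x, A, hAc, hAne⟩ := z
  obtain ⟨hx, hN, hP⟩ : (cauchyRep realMetric).Names (fstPart r) x ∧
    NegName realMetric (fstPart (sndPart r)) A ∧ PosName realMetric (sndPart (sndPart r)) A := hz
  have href := exists_refutes_iff hx hN hP hAne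
  have hnames : LLPO.repX.Names (join (firstRefutation r 0) (firstRefutation r 1))
      (firstRefutation r 0, firstRefutation r 1) := ⟨fstPart_join _ _, sndPart_join _ _⟩
  have hmem : ∀ i : Fin 2, candidate x A i ∈ A →
      i ∈ LLPO.f (firstRefutation r 0, firstRefutation r 1) := by
    intro i hi
    -- Candidate `i` lies in `A`, so only the other one can be refuted, and only its least
    -- certificate is marked.
    refine ⟨fun j j' n n' h h' => ?_, fun n => ?_⟩
    · rw [firstRefutation_pair, firstRefutation_ne_zero_iff] at h h'
      have hj := (href j).1 ⟨n, h.1⟩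
      have hj' := (href j').1 ⟨n', h'.1⟩
      have hjj : j = j' := by
        have hji : j ≠ i := by rintro rfl; exact hj hi
        have hji' : j' ≠ i := by rintro rfl; exact hj' hi
        omega
      subst hjj
      refine ⟨rfl, ?_⟩
      rcases lt_trichotomy n n' with hlt | heq | hlt
      · exact absurd h.1 (h'.2 n hlt)
      · exact heq
      · exact absurd h'.1 (h.2 n' hlt)
    · rw [firstRefutation_pair]
      exact firstRefutation_eq_zero_iff.2 (fun h => (href i).1 h hi) n
  obtain ⟨q, hq, i, hi, hqi⟩ := hG _ _ hnames (by
    rcases candidate_mem hAc hAne x with h | h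
    · exact ⟨(0 : Fin 2), hmem 0 h⟩
    · exact ⟨(1 : Fin 2), hmem 1 h⟩)
  change Fin 2 at i
  change q 0 = (i : ℕ) at hqi
  -- The sequence chosen by `LLPO` vanishes, so no certificate refutes this candidate.
  have hiA : candidate x A i ∈ A := by
    by_contra h
    refine firstRefutation_eq_zero_iff.1 (fun n => ?_) ((href i).2 h)
    rw [← firstRefutation_pair]
    exact hi.2 n
  obtain ⟨s, hs, hsv⟩ := hHspec (join r q) (fun n => by
    rw [fstPart_join]
    obtain ⟨w, m, k, hgc, he⟩ := exists_approxError_lt hx hN hP hAne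
      (show (0 : ℝ) < (1 / 2) ^ (n + 1) by positivity)
    refine ⟨Nat.pair w (Nat.pair m k), ?_⟩
    simp only [Nat.unpair_pair]
    refine ⟨hgc, ?_⟩
    rw [← Rat.cast_le (K := ℝ)]
    push_cast
    exact he.le)
  refine ⟨s, Part.mem_bind (Part.mem_some _) (Part.mem_bind hq hs), candidate x A i,
    ⟨hiA, dist_candidate x A i⟩, names_of_abs_sub_le fun n => ?_⟩
  obtain ⟨v, ⟨hgc, he⟩, hsn⟩ := hsv n
  have hq1 : join r q 1 = i := (congrFun (sndPart_join r q) 0).trans hqi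
  rw [fstPart_join] at hgc he
  rw [hsn, hcand, fstPart_join, hq1]
  refine (abs_candidateApprox_sub_le hx hN hP hAne i v.unpair.2.unpair.2 hgc).trans ?_
  have := (Rat.cast_le (K := ℝ)).2 he
  push_cast at this
  exact this

end Weihrauch

theorem mainTheorem6 :
    Weihrauch.Equivalent (Weihrauch.Proj Weihrauch.realMetric) Weihrauch.LLPO := by
  exact ⟨Weihrauch.proj_reducible_llpo, Weihrauch.llpo_reducible_proj⟩
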